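/- Let $F$ be an algebraically closed field of characteristic zero, $G=\{g_1,\dots,g_s\}$ a finite abelian group, and $A=\bigoplus_{g\in G}A_g$ a finite dimensional associative $G$-graded algebra over $F$ (not assumed to have a unit) that is graded simple, i.e. $A^2\neq 0$ and the only graded two-sided ideals of $A$ are $0$ and $A$. Put $p_i=\dim_F A_{g_i}$ for $1\le i\le s$. Let $F\langle X,G\rangle$ be the free associative algebra on the variables $x_{n,g}$ ($n\in\mathbb{N}$, $g\in G$), where $x_{n,g}$ has degree $g$; a graded substitution replaces every variable of degree $g$ by an element of $A_g$, and a graded identity of $A$ is a polynomial that vanishes under all graded substitutions in $A$. Then for every integer $t\ge 1$ there are pairwise disjoint sets $X^j_{g_i}$ ($1\le j\le 2t$, $1\le i\le s$), where $X^j_{g_i}$ consists of $p_i$ variables of degree $g_i$, and a polynomial $\varphi\in F\langle X,G\rangle$ such that 1. $\varphi$ is multilinear in the variables of $\bigcup_{i,j}X^j_{g_i}$ (every monomial of $\varphi$ contains each of these variables exactly once and no other variable), and $\varphi$ is alternating in the variables of each set $X^j_{g_i}$ (a permutation $\sigma$ of the variables of that set multiplies $\varphi$ by $\operatorname{sgn}\sigma$);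 that is, $\varphi$ is $2t$-fold $(p_1,\dots,p_s)$-alternating; 2. $\varphi$ is not a graded identity of $A$; 3. some graded substitution in $A$ gives $\varphi$ a value that is central and invertible in $A$ (in particular, $A$ has an identity element). -/

import Mathlib

namespace GradedPI

/-! ### Graded algebras

Algebras are associative and need not have a unit: an `F`-algebra is a `NonUnitalRing A` with
`[Module F A] [IsScalarTower F A A] [SMulCommClass F A A]`.
-/

section Graded

variable {F G A : Type*} [Field F] [Group G] [DecidableEq G] [NonUnitalRing A] [Module F A]

/-- `A = ⨁_{g ∈ G} A_g` as a vector space, with `A_g A_h ⊆ A_{gh}`. -/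
structure IsGrading (𝒜 : G → Submodule F A) : Prop where
  isInternal : DirectSum.IsInternal 𝒜
  mul_mem : ∀ ⦃g h : G⦄ ⦃a b : A⦄, a ∈ 𝒜 g → b ∈ 𝒜 h → a * b ∈ 𝒜 (g * h)

/-- A graded ideal: a subspace `I` closed under multiplication by `A` on both sides, with
`I = ∑_g I ∩ A_g`. -/
structure IsGradedIdeal (𝒜 : G → Submodule F A) (I : Submodule F A) : Prop where
  mul_mem_left : ∀ (a : A) ⦃x : A⦄, x ∈ I → a * x ∈ I
  mul_mem_right : ∀ (a : A) ⦃x : A⦄, x ∈ I → x * a ∈ I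
  homogeneous : I = ⨆ g, I ⊓ 𝒜 g

/-- `G`-graded simple: `A² ≠ 0`, and the only graded ideals are `0` and `A`. -/
structure IsGradedSimple (𝒜 : G → Submodule F A) : Prop where
  exists_mul_ne_zero : ∃ a b : A, a * b ≠ 0
  eq_bot_or_eq_top : ∀ I : Submodule F A, IsGradedIdeal 𝒜 I → I = ⊥ ∨ I = ⊤

/-- The `G`-dimension `(dim A_g)_{g ∈ G}`. -/
noncomputable def gDim (𝒜 : G → Submodule F A) (g : G) : ℕ :=
  Module.finrank F (𝒜 g)

end Graded

/-- `z` is invertible in `A`: the algebra `A` has an identity element `e`, and `z` has a two-sided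
inverse with respect to it. -/
def IsInvertible {A : Type*} [Mul A] (z : A) : Prop :=
  ∃ e : A, (∀ a : A, e * a = a ∧ a * e = a) ∧ ∃ w : A, z * w = e ∧ w * z = e

/-! ### Graded polynomials -/

/-- The variables: `(g, n)` is the `n`-th variable of homogeneous degree `g`. -/
abbrev Var (G : Type*) := G × ℕ

/-- The free associative `G`-graded algebra `F⟨X, G⟩` (without constant terms): its monomials are
the nonempty words in the variables. -/
abbrev GradedPoly (F G : Type*) [Field F] := MonoidAlgebra F (FreeSemigroup (Var G))

section Poly

variable {F G : Type*} [Field F]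

/-- The variable `x` as a polynomial. -/
noncomputable def var (x : Var G) : GradedPoly F G :=
  MonoidAlgebra.single (FreeSemigroup.of x) 1

/-- Substituting the element `ρ x` of an algebra for every variable `x`. -/
noncomputable def eval {B : Type*} [NonUnitalRing B] [Module F B] [IsScalarTower F B B]
    [SMulCommClass F B B] (ρ : Var G → B) : GradedPoly F G →ₙₐ[F] B :=
  MonoidAlgebra.liftMagma F (FreeSemigroup.lift ρ)

/-- Renaming the variables by a permutation. -/
noncomputable def rename (σ : Equiv.Perm (Var G)) : GradedPoly F G →ₙₐ[F] GradedPoly F G :=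
  eval fun x => var (σ x)

/-- `f` is multilinear in the variables of the finite set `V`: it is a linear combination of
monomials in which every variable of `V` occurs exactly once, and no other variable occurs. -/
def IsMultilinear (V : Finset (Var G)) (f : GradedPoly F G) : Prop :=
  f ∈ Submodule.span F {p : GradedPoly F G | ∃ w : FreeSemigroup (Var G),
    ((w.head :: w.tail : List (Var G)) : Multiset (Var G)) = V.val ∧ p = MonoidAlgebra.single w 1}

/-- `f` is alternating in the variables of the finite set `S`: every permutation `σ` of `S`
multiplies `f` by `sgn σ`. -/
def IsAlternating [DecidableEq G] (S : Finset (Var G)) (f : GradedPoly F G) : Prop :=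
  ∀ σ : Equiv.Perm S, rename (Equiv.Perm.ofSubtype σ) f = (Equiv.Perm.sign σ : ℤ) • f

/-- `f` is `t`-fold `(m_g)_{g ∈ G}`-alternating with respect to the sets of variables `X j g`
(for `j = 1, …, t` and `g ∈ G`), where `X j g` consists of `m g` variables of degree `g`, and
the finite set `Y` of remaining variables. -/
structure IsFoldAlternating [DecidableEq G] [Fintype G] (t : ℕ) (m : G → ℕ)
    (X : Fin t → G → Finset (Var G)) (Y : Finset (Var G)) (f : GradedPoly F G) : Prop where
  degree : ∀ j g, ∀ x ∈ X j g, x.1 = g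
  card : ∀ j g, (X j g).card = m g
  disjoint : ∀ i j g, i ≠ j → Disjoint (X i g) (X j g)
  disjoint_rest : ∀ j g, Disjoint (X j g) Y
  multilinear : IsMultilinear (((Finset.univ : Finset (Fin t × G)).biUnion fun p => X p.1 p.2) ∪ Y) f
  alternating : ∀ j g, IsAlternating (X j g) f

variable {A : Type*} [NonUnitalRing A] [Module F A]

/-- A graded substitution: every variable of degree `g` goes to an element of `A_g`. -/
def IsGradedSubst (𝒜 : G → Submodule F A) (ρ : Var G → A) : Prop :=
  ∀ x : Var G, ρ x ∈ 𝒜 x.1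

/-- `f` is a graded identity of `A`: it vanishes under all graded substitutions. -/
def IsGradedIdentity [IsScalarTower F A A] [SMulCommClass F A A] (𝒜 : G → Submodule F A)
    (f : GradedPoly F G) : Prop :=
  ∀ ρ : Var G → A, IsGradedSubst 𝒜 ρ → eval ρ f = 0

end Poly

end GradedPI

namespace GradedPI

/-!
A graded simple algebra has a quotient `p : A → Mₙ(F)` by an ungraded ideal. A bimodule argument
shows that the images of two components are equal when their degrees differ by an element of a
certain subgroup `H`, and that the images of the components for different cosets of `H` form a
direct sum. Hence `Mₙ(F)` has a basis `b` of `n ^ 2` images of homogeneous elements, and the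
positions `(g, i)` with `i ≤ dim A_g` fall into `|H|` copies of `b` such that the positions of each
degree lie in one copy. Regev's polynomial alternates in two sets of `n ^ 2` variables and takes a
nonzero scalar value at `b`; a product of `t * |H|` of them, `t` for each copy, is the polynomial
required. Under `p` its value at homogeneous preimages of `b` is a central unit, and a homogeneous
element with this property is central and invertible, because the kernel and the image of the
multiplication by it, as well as the commutators with it, are controlled by graded ideals.

The value of Regev's polynomial is a scalar by conjugation invariance. Its trace is nonzero for a
suitable arrangement of the variables: let `T` be the alternating tensor of all `n ^ 2` matrix
units. By the first fundamental theorem `T` has a nonzero trace against some permutation `π`, which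
we take with the least number of cycles. The signs force the cycles of `π` to have distinct odd
lengths, so there are at most `n` of them. Joining two copies of `π` along one point of each cycle
gives a full cycle of length `2 * n ^ 2`, and by minimality the trace of `T ⊗ T` against it is a
nonzero multiple of a value of the Weingarten function on at most `n` points. These values are not
zero: up to signs, the Weingarten function is inverse to a product of shifted Jucys–Murphy elements,
each of which acts by an M-matrix.
-/

open Equiv Finset

section Weingarten

variable {α β : Type*}

/-- The number of functions `α → κ` that are invariant under `σ`; it equals `|κ| ^ c`, where `c` is
the number of cycles of `σ`. -/
noncomputable def numInvariant (κ : Type*) (σ : Perm α) : ℕ :=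
  Nat.card {a : α → κ // a ∘ σ = a}

lemma numInvariant_permCongr (κ : Type*) (e : α ≃ β) (σ : Perm α) :
    numInvariant κ (e.permCongr σ) = numInvariant κ σ := by
  refine Nat.card_congr ((e.symm.arrowCongr (Equiv.refl κ)).subtypeEquiv fun a => ?_)
  simp only [funext_iff, Function.comp_apply, permCongr_apply, arrowCongr_apply, symm_symm,
    refl_apply]
  rw [← e.forall_congr_right]
  simp only [symm_apply_apply]

lemma comp_optionCongr_eq_iff {κ : Type*} {σ : Perm α} {a : Option α → κ} :
    a ∘ optionCongr σ = a ↔ (a ∘ some) ∘ σ = a ∘ some := by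
  simp [funext_iff, Option.forall]

lemma numInvariant_optionCongr (κ : Type*) (σ : Perm α) :
    numInvariant κ (optionCongr σ) = Nat.card κ * numInvariant κ σ := by
  rw [numInvariant, numInvariant, ← Nat.card_prod]
  exact Nat.card_congr
    { toFun := fun a => (a.1 none, ⟨a.1 ∘ some, comp_optionCongr_eq_iff.1 a.2⟩)
      invFun := fun x => ⟨fun y => y.elim x.1 x.2.1, comp_optionCongr_eq_iff.2 x.2.2⟩
      left_inv := fun a => Subtype.ext (funext fun y => by cases y <;> rfl)
      right_inv := fun _ => rfl }

variable [DecidableEq α]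

lemma comp_swap_mul_optionCongr_eq_iff {κ : Type*} {σ : Perm α} {x : α} {a : Option α → κ} :
    a ∘ (swap none (some x) * optionCongr σ) = a ↔
      a none = a (some x) ∧ (a ∘ some) ∘ σ = a ∘ some := by
  have hswap (h : a none = a (some x)) : a ∘ swap none (some x) = a := by
    ext y
    rw [Function.comp_apply, swap_apply_def]
    split_ifs <;> simp [*]
  rw [Perm.coe_mul, ← Function.comp_assoc]
  constructor
  · intro h
    have h₀ : a none = a (some x) := by simpa using (congrFun h none).symm
    rw [hswap h₀] at h
    exact ⟨h₀, comp_optionCongr_eq_iff.1 h⟩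
  · rintro ⟨h₀, h⟩
    rw [hswap h₀]
    exact comp_optionCongr_eq_iff.2 h

lemma numInvariant_swap_mul_optionCongr (κ : Type*) (σ : Perm α) (x : α) :
    numInvariant κ (swap none (some x) * optionCongr σ) = numInvariant κ σ :=
  Nat.card_congr
    { toFun := fun a => ⟨a.1 ∘ some, (comp_swap_mul_optionCongr_eq_iff.1 a.2).2⟩
      invFun := fun b =>
        ⟨fun y => y.elim (b.1 x) b.1, comp_swap_mul_optionCongr_eq_iff.2 ⟨rfl, b.2⟩⟩
      left_inv := fun a => Subtype.ext (funext fun y => by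
        cases y
        exacts [(comp_swap_mul_optionCongr_eq_iff.1 a.2).1.symm, rfl])
      right_inv := fun _ => rfl }

/-- The product in the rational group algebra of `v` and `∑ g, sign g * numInvariant κ g • g`. -/
noncomputable def signedConv [Fintype α] (κ : Type*) (v : Perm α → ℚ) (π : Perm α) : ℚ :=
  ∑ g, v (π * g⁻¹) * ((Perm.sign g : ℤ) * numInvariant κ g)

lemma signedConv_permCongr [Fintype α] [Fintype β] [DecidableEq β] (κ : Type*) (e : α ≃ β)
    (v : Perm β → ℚ) (π : Perm α) :
    signedConv κ v (e.permCongr π) = signedConv κ (fun σ => v (e.permCongr σ)) π := by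
  rw [signedConv, signedConv, ← e.permCongr.sum_comp]
  refine sum_congr rfl fun g _ => ?_
  rw [numInvariant_permCongr, Perm.sign_permCongr, ← permCongrHom_coe e, ← map_inv, ← map_mul]

/-- Right multiplication by the element `|κ| - ∑ x, (none x)` of the rational group algebra, a
shifted Jucys–Murphy element. -/
noncomputable def jucysMul [Fintype α] (κ : Type*) (v : Perm (Option α) → ℚ)
    (π : Perm (Option α)) : ℚ :=
  Nat.card κ * v π - ∑ x, v (π * swap none (some x))

-- Every permutation of `Option α` is uniquely `swap none y * optionCongr σ`, so
-- `∑ g, sign g * numInvariant κ g • g` is a product of shifted Jucys–Murphy elements.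
lemma signedConv_mul_optionCongr [Fintype α] (κ : Type*) (v : Perm (Option α) → ℚ)
    (π : Perm (Option α)) (τ : Perm α) :
    signedConv κ v (π * optionCongr τ) =
      signedConv κ (fun σ => jucysMul κ v (π * optionCongr σ)) τ := by
  have hmul (σ : Perm α) : optionCongr (τ * σ⁻¹) = optionCongr τ * (optionCongr σ)⁻¹ := by
    ext x; cases x <;> rfl
  rw [signedConv, signedConv, ← Perm.decomposeOption.symm.sum_comp, Fintype.sum_prod_type_right]
  refine sum_congr rfl fun σ _ => ?_
  simp only [jucysMul, Fintype.sum_option, Perm.decomposeOption_symm_apply, hmul, mul_assoc,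
    numInvariant_swap_mul_optionCongr, mul_inv_rev, swap_inv, Perm.sign_mul, optionCongr_sign,
    Perm.sign_swap (Option.some_ne_none _).symm]
  rw [swap_self, ← Perm.one_def, mul_one, one_mul, numInvariant_optionCongr, sub_mul, sum_mul,
    sub_eq_add_neg, ← sum_neg_distrib, Perm.sign_one]
  push_cast
  congr 1
  · ring
  · exact sum_congr rfl fun x _ => by ring

lemma nonneg_of_jucysMul_nonneg [Fintype α] {κ : Type*} (hα : Fintype.card α < Nat.card κ)
    {v : Perm (Option α) → ℚ} (h : ∀ π, 0 ≤ jucysMul κ v π) (π : Perm (Option α)) : 0 ≤ v π := by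
  obtain ⟨π₀, -, hmin⟩ := exists_min_image univ v univ_nonempty
  have hsum : Fintype.card α * v π₀ ≤ ∑ x, v (π₀ * swap none (some x)) := by
    simpa using card_nsmul_le_sum univ _ _ fun (x : α) _ =>
      hmin (π₀ * swap none (some x)) (mem_univ _)
  have hcard : (Fintype.card α : ℚ) + 1 ≤ Nat.card κ := by exact_mod_cast hα
  have hπ₀ := h π₀
  rw [jucysMul] at hπ₀
  refine le_trans ?_ (hmin π (mem_univ π))
  by_contra! hneg
  nlinarith

lemma exists_eq_mul_optionCongr_mul_swap (π τ : Perm (Option α)) :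
    ∃ σ : Perm α, ∃ y : Option α, τ = π * optionCongr σ * swap none y := by
  obtain ⟨⟨y, σ⟩, h⟩ := Perm.decomposeOption.symm.surjective (τ⁻¹ * π)
  rw [Perm.decomposeOption_symm_apply] at h
  refine ⟨σ⁻¹, y, ?_⟩
  calc τ = π * (τ⁻¹ * π)⁻¹ := by group
    _ = π * (optionCongr σ)⁻¹ * swap none y := by rw [← h, mul_inv_rev, swap_inv, mul_assoc]

lemma pos_of_jucysMul_pos [Fintype α] {κ : Type*} {v : Perm (Option α) → ℚ}
    (hv : ∀ π, 0 ≤ v π) (h : ∀ π, 0 ≤ jucysMul κ v π) {π : Perm (Option α)}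
    (hπ : ∀ σ, 0 < jucysMul κ v (π * optionCongr σ)) (τ : Perm (Option α)) : 0 < v τ := by
  have hπv (σ : Perm α) : 0 < v (π * optionCongr σ) := by
    have hpos : 0 < Nat.card κ * v (π * optionCongr σ) :=
      (hπ σ).trans_le (sub_le_self _ (sum_nonneg fun _ _ => hv _))
    exact pos_of_mul_pos_right hpos (Nat.cast_nonneg _)
  obtain ⟨σ, _ | x, rfl⟩ := exists_eq_mul_optionCongr_mul_swap π τ
  · rw [swap_self, ← Perm.one_def, mul_one]
    exact hπv σ
  · have hle : v (π * optionCongr σ) ≤ ∑ y,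
        v (π * optionCongr σ * swap none (some x) * swap none (some y)) := by
      simpa [mul_assoc] using single_le_sum (f := fun y =>
        v (π * optionCongr σ * swap none (some x) * swap none (some y)))
        (fun _ _ => hv _) (mem_univ x)
    have hpos : 0 < Nat.card κ * v (π * optionCongr σ * swap none (some x)) :=
      (hπv σ).trans_le (hle.trans (sub_nonneg.1 (h _)))
    exact pos_of_mul_pos_right hpos (Nat.cast_nonneg _)

lemma signedConv_of_isEmpty [Fintype α] [IsEmpty α] (κ : Type*) (v : Perm α → ℚ) (π : Perm α) :
    signedConv κ v π = v π := by
  have hone : numInvariant κ (1 : Perm α) = 1 :=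
    Nat.card_eq_one_iff_unique.2 ⟨inferInstance, ⟨⟨isEmptyElim, rfl⟩⟩⟩
  rw [signedConv, Fintype.sum_subsingleton _ 1, hone]
  simp

-- For `|α| ≤ |κ|` every factor of the convolution is right multiplication by an M-matrix, whose
-- inverse is nonnegative.
lemma pos_of_signedConv_nonneg [Fintype α] {κ : Type*} (hα : Fintype.card α ≤ Nat.card κ)
    {v : Perm α → ℚ} (h : ∀ π, 0 ≤ signedConv κ v π) :
    (∀ π, 0 ≤ v π) ∧ ((∃ π, 0 < signedConv κ v π) → ∀ π, 0 < v π) := by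
  refine Fintype.induction_empty_option (P := fun α _ => ∀ [DecidableEq α],
    Fintype.card α ≤ Nat.card κ → ∀ v : Perm α → ℚ, (∀ π, 0 ≤ signedConv κ v π) →
      (∀ π, 0 ≤ v π) ∧ ((∃ π, 0 < signedConv κ v π) → ∀ π, 0 < v π)) ?_ ?_ ?_ α hα v h
  · intro α β _ e ih _ hβ v h
    classical
    let := Fintype.ofEquiv β e.symm
    have hv := ih ((Fintype.card_congr e).trans_le hβ) fun σ => v (e.permCongr σ)
    simp only [← signedConv_permCongr] at hv
    simpa only [e.permCongr.forall_congr_right (q := fun π => 0 ≤ v π),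
      e.permCongr.forall_congr_right (q := fun π => 0 < v π),
      e.permCongr.exists_congr_right (q := fun π => 0 < signedConv κ v π)] using
        hv fun π => h (e.permCongr π)
  · intro _ _ v h
    simp only [signedConv_of_isEmpty] at h ⊢
    refine ⟨h, fun ⟨π, hπ⟩ τ => ?_⟩
    rwa [Subsingleton.elim τ π]
  · intro α _ ih inst hα v h
    classical
    obtain rfl : inst = Option.instDecidableEq := Subsingleton.elim _ _
    rw [Fintype.card_option] at hα
    have ihπ (π : Perm (Option α)) :=
      ih (Nat.le_of_succ_le hα) (fun σ => jucysMul κ v (π * optionCongr σ))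
        fun τ => by rw [← signedConv_mul_optionCongr]; exact h _
    have hjucys (π : Perm (Option α)) : 0 ≤ jucysMul κ v π := by
      simpa only [optionCongr_one, mul_one] using (ihπ π).1 1
    have hv := nonneg_of_jucysMul_nonneg hα hjucys
    refine ⟨hv, fun ⟨π, hπ⟩ => pos_of_jucysMul_pos hv hjucys ((ihπ π).2 ⟨1, ?_⟩)⟩
    rwa [← signedConv_mul_optionCongr, optionCongr_one, mul_one]

/-- `w` is, up to the factor `c`, the Weingarten function of the group of `κ × κ` matrices. -/
theorem weingarten_ne_zero [Fintype α] {κ : Type*} (hα : Fintype.card α ≤ Nat.card κ)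
    {w : Perm α → ℚ} {c : ℚ} (hc : c ≠ 0)
    (hw : ∀ ρ, ∑ g, w (g * ρ) * numInvariant κ g = if ρ = 1 then c else 0) (σ : Perm α) :
    w σ ≠ 0 := by
  have hsign (g : Perm α) : ((Perm.sign g : ℤ) : ℚ) * (Perm.sign g : ℤ) = 1 := by
    exact_mod_cast Int.isUnit_mul_self (Perm.sign g).isUnit
  set v : Perm α → ℚ := fun τ => c⁻¹ * (Perm.sign τ : ℤ) * w τ⁻¹ with hv
  have hconv (π : Perm α) : signedConv κ v π = if π = 1 then 1 else 0 := calc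
    signedConv κ v π = c⁻¹ * (Perm.sign π : ℤ) * ∑ g, w (g * π⁻¹) * numInvariant κ g := by
      rw [signedConv, mul_sum]
      refine sum_congr rfl fun g _ => ?_
      simp only [hv, mul_inv_rev, inv_inv, Perm.sign_mul, Perm.sign_inv]
      push_cast
      linear_combination
        (c⁻¹ * (Perm.sign π : ℤ) * w (g * π⁻¹) * numInvariant κ g) * hsign g
    _ = if π = 1 then 1 else 0 := by
      rw [hw]
      rcases eq_or_ne π 1 with rfl | hπ <;> simp [*]
  have hpos : 0 < v σ⁻¹ :=
    (pos_of_signedConv_nonneg hα fun π => by rw [hconv]; split_ifs <;> norm_num).2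
      ⟨1, by simp [hconv]⟩ σ⁻¹
  intro h₀
  simp [hv, h₀] at hpos

end Weingarten

section DoubleCentralizer

/-- The double centralizer theorem for a representation of a finite group. -/
theorem mem_range_asAlgebraHom_of_commute {k G V : Type*} [Field k] [Group G] [Finite G]
    [NeZero (Nat.card G : k)] [AddCommGroup V] [Module k V] [FiniteDimensional k V]
    (ρ : Representation k G V) {T : Module.End k V}
    (hT : ∀ φ : Module.End k V, (∀ g, Commute φ (ρ g)) → Commute T φ) :
    T ∈ ρ.asAlgebraHom.range := by
  classical
  let f : Module.End (Module.End (MonoidAlgebra k G) ρ.asModule) ρ.asModule :=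
    { toFun := fun v => ρ.asModuleEquiv.symm (T (ρ.asModuleEquiv v))
      map_add' := fun v w => by simp only [map_add]
      map_smul' := fun φ v => by
        let φ' : Module.End k V := ρ.asModuleEquiv.toLinearMap ∘ₗ φ.restrictScalars k ∘ₗ
          ρ.asModuleEquiv.symm.toLinearMap
        have hφ' (g : G) : Commute φ' (ρ g) := LinearMap.ext fun w => by
          simp only [φ', Module.End.mul_apply, LinearMap.comp_apply, LinearEquiv.coe_coe,
            LinearMap.restrictScalars_apply]
          rw [ρ.asModuleEquiv_symm_map_rho, map_smul, ρ.asModuleEquiv_map_smul,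
            Representation.asAlgebraHom_of]
        have hTφ' := congrArg ρ.asModuleEquiv.symm
          (LinearMap.congr_fun (hT φ' hφ').eq (ρ.asModuleEquiv v))
        simpa [φ'] using hTφ' }
  let b := Module.finBasis k V
  obtain ⟨r, hr⟩ := jacobson_density f (univ.image fun i => ρ.asModuleEquiv.symm (b i))
  refine ⟨r, (b.ext fun i => ?_).symm⟩
  have hi := congrArg ρ.asModuleEquiv (hr _ (mem_image_of_mem _ (mem_univ i)))
  rw [ρ.asModuleEquiv_map_smul] at hi
  simpa [f] using hi

end DoubleCentralizer

section TensorPower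

/-- The permutation representation on the tensor power. -/
def tensorRep (k ι κ : Type*) [Field k] : Representation k (Perm ι) ((ι → κ) → k) where
  toFun σ := LinearMap.funLeft k k fun f : ι → κ => f ∘ σ
  map_one' := rfl
  map_mul' _ _ := rfl

lemma tensorRep_apply {k ι κ : Type*} [Field k] (σ : Perm ι) (v : (ι → κ) → k) (f : ι → κ) :
    tensorRep k ι κ σ v f = v (f ∘ σ) := rfl

variable {ι κ R : Type*} [Fintype ι] [CommRing R]

/-- The Kronecker product of a family of matrices, as a matrix on the tensor power. -/
def kroneckerFamily (x : ι → Matrix κ κ R) : Matrix (ι → κ) (ι → κ) R :=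
  Matrix.of fun f g => ∏ i, x i (f i) (g i)

lemma kroneckerFamily_apply (x : ι → Matrix κ κ R) (f g : ι → κ) :
    kroneckerFamily x f g = ∏ i, x i (f i) (g i) := rfl

lemma map_kroneckerFamily {S : Type*} [CommRing S] (φ : R →+* S) (x : ι → Matrix κ κ R) :
    (kroneckerFamily x).map φ = kroneckerFamily fun i => (x i).map φ := by
  ext f g
  simp only [Matrix.map_apply, kroneckerFamily_apply, map_prod]

lemma kroneckerFamily_one [DecidableEq κ] :
    kroneckerFamily (fun _ : ι => (1 : Matrix κ κ R)) = 1 := by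
  ext f g
  simp only [kroneckerFamily_apply, Matrix.one_apply, prod_ite_zero]
  simp [funext_iff]

lemma kroneckerFamily_single [DecidableEq κ] (f g a b : ι → κ) :
    kroneckerFamily (fun i => Matrix.single (f i) (g i) (1 : R)) a b =
      if f = a ∧ g = b then 1 else 0 := by
  simp [kroneckerFamily_apply, Matrix.single_apply, prod_ite_zero, funext_iff, forall_and]

variable [DecidableEq ι]

/-- Ryser's formula. -/
lemma permanent_eq_sum_powerset (y : Matrix ι ι R) :
    y.permanent = ∑ J : Finset ι, (-1 : R) ^ J.card * ∏ i, ∑ j ∈ Jᶜ, y j i := by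
  let missing (j : ι) : Finset (ι → ι) := univ.filter fun h => ∀ i, h i ≠ j
  have hsurj : y.permanent = ∑ h ∈ univ.inf fun j => (missing j)ᶜ, ∏ i, y (h i) i := by
    refine sum_bij (fun σ _ => σ) (fun σ _ => ?_) (fun _ _ _ _ h => Equiv.ext (congrFun h))
      (fun h hh => ?_) fun _ _ => rfl
    · simpa [mem_inf, missing] using fun j => σ.surjective j
    · have hh' : Function.Surjective h := fun j => by
        simpa [missing] using mem_inf.1 hh j (mem_univ j)
      exact ⟨Equiv.ofBijective h (Finite.surjective_iff_bijective.1 hh'), mem_univ _, rfl⟩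
  have hmissing (J : Finset ι) : J.inf missing = Fintype.piFinset fun _ => Jᶜ := by
    ext h
    simp only [mem_inf, missing, mem_filter, mem_univ, true_and, Fintype.mem_piFinset, mem_compl]
    exact ⟨fun H i hi => H _ hi i rfl, fun H j hj i hij => H i (hij ▸ hj)⟩
  rw [hsurj, inclusion_exclusion_sum_inf_compl, powerset_univ]
  refine sum_congr rfl fun J _ => ?_
  rw [hmissing, prod_univ_sum, zsmul_eq_mul]
  push_cast
  rfl

lemma sum_perm_kroneckerFamily (x : ι → Matrix κ κ R) :
    ∑ σ : Perm ι, kroneckerFamily (fun i => x (σ i)) =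
      ∑ J : Finset ι, (-1 : R) ^ J.card • kroneckerFamily fun _ : ι => ∑ j ∈ Jᶜ, x j := by
  ext f g
  simp only [Matrix.sum_apply, Matrix.smul_apply, smul_eq_mul, kroneckerFamily_apply]
  exact permanent_eq_sum_powerset fun j i => x j (f i) (g i)

variable [Fintype κ]

lemma kroneckerFamily_mul (x y : ι → Matrix κ κ R) :
    kroneckerFamily x * kroneckerFamily y = kroneckerFamily fun i => x i * y i := by
  ext f g
  simp only [Matrix.mul_apply, kroneckerFamily_apply, ← prod_mul_distrib]
  rw [prod_univ_sum, Fintype.piFinset_univ]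

variable [DecidableEq κ]

lemma card_smul_eq_sum_kroneckerFamily (Φ : Matrix (ι → κ) (ι → κ) R)
    (hΦ : ∀ (σ : Perm ι) f g, Φ (f ∘ σ) (g ∘ σ) = Φ f g) :
    (Fintype.card (Perm ι) : R) • Φ = ∑ f : ι → κ, ∑ g : ι → κ, Φ f g •
      ∑ σ : Perm ι, kroneckerFamily fun i => Matrix.single (f (σ i)) (g (σ i)) (1 : R) := by
  have hσ (σ : Perm ι) : Φ = ∑ f : ι → κ, ∑ g : ι → κ, Φ f g •
      kroneckerFamily fun i => Matrix.single (f (σ i)) (g (σ i)) (1 : R) := by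
    ext a b
    have happly (f g : ι → κ) :
        kroneckerFamily (fun i => Matrix.single (f (σ i)) (g (σ i)) (1 : R)) a b =
          if f = a ∘ σ.symm ∧ g = b ∘ σ.symm then 1 else 0 := by
      simp only [Equiv.eq_comp_symm]
      exact kroneckerFamily_single (f ∘ σ) (g ∘ σ) a b
    simp only [Matrix.sum_apply, Matrix.smul_apply, happly, smul_eq_mul, ite_and]
    simp [hΦ]
  calc (Fintype.card (Perm ι) : R) • Φ = ∑ _σ : Perm ι, Φ := by
        rw [sum_const, card_univ, Nat.cast_smul_eq_nsmul]
    _ = ∑ σ : Perm ι, ∑ f : ι → κ, ∑ g : ι → κ, Φ f g •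
          kroneckerFamily fun i => Matrix.single (f (σ i)) (g (σ i)) (1 : R) :=
        sum_congr rfl fun σ _ => hσ σ
    _ = _ := by
        rw [sum_comm]
        exact sum_congr rfl fun f _ => by
          rw [sum_comm]
          exact sum_congr rfl fun g _ => by rw [smul_sum]

section Field

variable {k : Type*} [Field k]

-- The entries of the commutator with the tensor power of `c + g` are polynomials in `c` that vanish
-- whenever `c + g` is invertible.
lemma commute_kroneckerFamily_of_isUnit [Infinite k] {M : Matrix (ι → κ) (ι → κ) k}
    (h : ∀ g : Matrix κ κ k, IsUnit g.det → Commute M (kroneckerFamily fun _ : ι => g))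
    (g : Matrix κ κ k) : Commute M (kroneckerFamily fun _ : ι => g) := by
  let gX : Matrix κ κ (Polynomial k) := Matrix.scalar κ Polynomial.X + g.map Polynomial.C
  let D := M.map Polynomial.C * (kroneckerFamily fun _ : ι => gX) -
    (kroneckerFamily fun _ : ι => gX) * M.map Polynomial.C
  have heval (c : k) : D.map (Polynomial.evalRingHom c) =
      M * (kroneckerFamily fun _ : ι => Matrix.scalar κ c + g) -
        (kroneckerFamily fun _ : ι => Matrix.scalar κ c + g) * M := by
    have hM : (M.map Polynomial.C).map (Polynomial.evalRingHom c) = M := by ext; simp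
    have hgX : gX.map (Polynomial.evalRingHom c) = Matrix.scalar κ c + g := by
      ext a b
      simp only [gX, Matrix.map_apply, Matrix.add_apply, Matrix.scalar_apply,
        Matrix.diagonal_apply, map_add]
      split_ifs <;> simp
    rw [Matrix.map_sub _ (map_sub _), Matrix.map_mul, Matrix.map_mul, map_kroneckerFamily, hM, hgX]
  have hD : D = 0 := by
    ext1 f f'
    refine Polynomial.eq_zero_of_infinite_isRoot _ ?_
    have hfin : {c : k | (-g).charpoly.IsRoot c}.Finite :=
      Polynomial.finite_setOfPred_isRoot (Matrix.charpoly_monic _).ne_zero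
    refine hfin.infinite_compl.mono fun c hc => ?_
    have hunit : IsUnit (Matrix.scalar κ c + g).det := by
      simpa [Polynomial.IsRoot, Matrix.eval_charpoly] using hc
    have hzero := heval c
    rw [(h _ hunit).eq, sub_self] at hzero
    exact congrFun (congrFun hzero f) f'
  have h₀ := heval 0
  rw [hD, Matrix.map_zero _ (map_zero _), map_zero, zero_add] at h₀
  exact sub_eq_zero.1 h₀.symm

lemma commute_of_comp_perm_eq [CharZero k] {M : Matrix (ι → κ) (ι → κ) k}
    (h : ∀ g : Matrix κ κ k, IsUnit g.det → Commute M (kroneckerFamily fun _ : ι => g))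
    {Φ : Matrix (ι → κ) (ι → κ) k} (hΦ : ∀ (σ : Perm ι) f g, Φ (f ∘ σ) (g ∘ σ) = Φ f g) :
    Commute M Φ := by
  have hsym (x : ι → Matrix κ κ k) :
      Commute M (∑ σ : Perm ι, kroneckerFamily fun i => x (σ i)) := by
    rw [sum_perm_kroneckerFamily]
    exact Commute.sum_right _ _ _ fun J _ =>
      (commute_kroneckerFamily_of_isUnit h _).smul_right _
  have hcard : Commute M ((Fintype.card (Perm ι) : k) • Φ) := by
    rw [card_smul_eq_sum_kroneckerFamily Φ hΦ]
    exact Commute.sum_right _ _ _ fun f _ => Commute.sum_right _ _ _ fun g _ =>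
      (hsym fun i => Matrix.single (f i) (g i) 1).smul_right _
  rwa [Commute.smul_right_iff₀ (by exact_mod_cast Fintype.card_ne_zero)] at hcard

lemma toMatrix'_comp_perm_of_commute {φ : Module.End k ((ι → κ) → k)}
    (hφ : ∀ σ, Commute φ (tensorRep k ι κ σ)) (σ : Perm ι) (f g : ι → κ) :
    LinearMap.toMatrix' φ (f ∘ σ) (g ∘ σ) = LinearMap.toMatrix' φ f g := by
  have hbasis : tensorRep k ι κ σ (Pi.single (g ∘ σ) 1) = Pi.single g 1 := by
    ext f
    simp [tensorRep_apply, Pi.single_apply, σ.surjective.right_cancellable]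
  have hσ := congrFun (LinearMap.congr_fun (hφ σ).eq (Pi.single (g ∘ σ) 1)) f
  simpa [hbasis, tensorRep_apply, LinearMap.toMatrix'_apply] using hσ.symm

/-- The first fundamental theorem for matrix invariants. -/
theorem exists_perm_coeff [CharZero k] {M : Matrix (ι → κ) (ι → κ) k}
    (h : ∀ g : Matrix κ κ k, IsUnit g.det → Commute M (kroneckerFamily fun _ : ι => g)) :
    ∃ w : Perm ι → k, ∀ f g, M f g = ∑ σ, w σ * if f ∘ σ = g then 1 else 0 := by
  have : NeZero (Nat.card (Perm ι) : k) := ⟨by exact_mod_cast Nat.card_pos.ne'⟩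
  obtain ⟨r, hr⟩ : Matrix.toLin' M ∈ (tensorRep k ι κ).asAlgebraHom.range := by
    refine mem_range_asAlgebraHom_of_commute _ fun φ hφ => ?_
    have hcomm := commute_of_comp_perm_eq h (toMatrix'_comp_perm_of_commute hφ)
    rw [← Matrix.toLin'_toMatrix' φ]
    exact hcomm.map (Matrix.toLinAlgEquiv' (R := k))
  refine ⟨fun σ => r.coeff σ, fun f g => ?_⟩
  have hfg := congrFun (LinearMap.congr_fun hr (Pi.single g 1)) f
  rw [AlgHom.toRingHom_eq_coe, RingHom.coe_coe, Representation.asAlgebraHom_def,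
    MonoidAlgebra.lift_apply, Finsupp.sum_fintype _ _ (by simp), Matrix.toLin'_apply,
    Matrix.mulVec_single_one] at hfg
  simpa [tensorRep_apply, Pi.single_apply] using hfg.symm

end Field

end TensorPower

section AlternatingTensor

variable {κ R : Type*} [DecidableEq κ] [CommRing R]

/-- The matrix of coordinates of a family of matrices in the basis of matrix units. -/
def coordMatrix {ι : Type*} (x : ι → Matrix κ κ R) : Matrix ι (κ × κ) R :=
  Matrix.of fun j p => x j p.1 p.2

/-- The matrix units, indexed by the pairs of a row and a column. -/
def matrixUnit (R : Type*) [CommRing R] (p : κ × κ) : Matrix κ κ R :=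
  Matrix.single p.1 p.2 1

lemma coordMatrix_matrixUnit : coordMatrix (matrixUnit R (κ := κ)) = 1 := by
  ext i p
  simp only [coordMatrix, matrixUnit, Matrix.of_apply, Matrix.single_apply, Matrix.one_apply,
    Prod.ext_iff]

variable [Fintype κ]

lemma coordMatrix_mul_matrixUnit_mul (g h : Matrix κ κ R) :
    coordMatrix (fun i => g * matrixUnit R i * h) = Matrix.kroneckerMap (· * ·) g.transpose h := by
  ext ⟨i, i'⟩ ⟨j, j'⟩
  simp [coordMatrix, matrixUnit, Matrix.mul_apply, Matrix.single_apply, ite_and, mul_ite]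

/-- The alternating sum of the Kronecker products of all arrangements of the matrix units, see
`altTensor_eq`; its entries are written as determinants. -/
def altTensor (R : Type*) [CommRing R] : Matrix (κ × κ → κ) (κ × κ → κ) R :=
  Matrix.of fun f g => (Matrix.of fun p i : κ × κ => if p = (f i, g i) then (1 : R) else 0).det

lemma sum_sign_prod_eq (x : κ × κ → Matrix κ κ R) (f g : κ × κ → κ) :
    ∑ σ : Perm (κ × κ), ((Perm.sign σ : ℤ) : R) * ∏ i, x (σ i) (f i) (g i) =
      (coordMatrix x).det * altTensor R f g := by
  rw [altTensor, Matrix.of_apply, ← Matrix.det_mul, Matrix.det_apply']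
  simp [Matrix.mul_apply, coordMatrix]

lemma sum_sign_kroneckerFamily (x : κ × κ → Matrix κ κ R) :
    ∑ σ : Perm (κ × κ), ((Perm.sign σ : ℤ) : R) • kroneckerFamily (fun i => x (σ i)) =
      (coordMatrix x).det • altTensor R := by
  ext f g
  simp only [Matrix.sum_apply, Matrix.smul_apply, kroneckerFamily_apply, smul_eq_mul,
    sum_sign_prod_eq]

lemma altTensor_eq : altTensor R (κ := κ) = ∑ σ : Perm (κ × κ), ((Perm.sign σ : ℤ) : R) •
    kroneckerFamily (fun i => matrixUnit R (σ i)) := by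
  rw [sum_sign_kroneckerFamily, coordMatrix_matrixUnit, Matrix.det_one, one_smul]

lemma kroneckerFamily_mul_altTensor_mul (g h : Matrix κ κ R) :
    (kroneckerFamily fun _ : κ × κ => g) * altTensor R * (kroneckerFamily fun _ : κ × κ => h) =
      (Matrix.kroneckerMap (· * ·) g.transpose h).det • altTensor R := by
  rw [← coordMatrix_mul_matrixUnit_mul, ← sum_sign_kroneckerFamily, altTensor_eq, mul_sum, sum_mul]
  simp only [mul_smul_comm, smul_mul_assoc, kroneckerFamily_mul]

lemma altTensor_commute (g : Matrix κ κ R) :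
    Commute (altTensor R) (kroneckerFamily fun _ : κ × κ => g) := by
  have hright := kroneckerFamily_mul_altTensor_mul 1 g
  have hleft := kroneckerFamily_mul_altTensor_mul g 1
  rw [kroneckerFamily_one, one_mul, Matrix.transpose_one] at hright
  rw [kroneckerFamily_one, mul_one] at hleft
  rw [Commute, SemiconjBy, hright, hleft, Matrix.det_kronecker, Matrix.det_kronecker,
    Matrix.det_transpose, Matrix.det_one, one_pow, one_mul, mul_one]

lemma altTensor_comp (f g : κ × κ → κ) (τ : Perm (κ × κ)) :
    altTensor R (f ∘ τ) (g ∘ τ) = ((Perm.sign τ : ℤ) : R) * altTensor R f g := by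
  rw [altTensor, Matrix.of_apply, Matrix.of_apply, ← Matrix.det_permute']
  rfl

lemma altTensor_fst_snd : altTensor R (Prod.fst : κ × κ → κ) Prod.snd = 1 :=
  Matrix.det_one (n := κ × κ)

/-- The trace of the alternating tensor against a permutation of the factors: the alternating sum
of the corresponding product of traces of products of matrix units. -/
def altTrace (κ : Type*) [DecidableEq κ] [Fintype κ] (π : Perm (κ × κ)) : ℚ :=
  ∑ f : κ × κ → κ, altTensor ℚ f (f ∘ π)

-- By the first fundamental theorem the sum of the squares of the entries of the alternating tensor
-- is a combination of the numbers `altTrace κ π`.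
lemma exists_altTrace_ne_zero (κ : Type*) [DecidableEq κ] [Fintype κ] :
    ∃ π, altTrace κ π ≠ 0 := by
  by_contra! h
  obtain ⟨w, hw⟩ := exists_perm_coeff (M := altTensor ℚ (κ := κ)) fun g _ => altTensor_commute g
  have hsquares : ∑ f : κ × κ → κ, ∑ g, altTensor ℚ f g * altTensor ℚ f g = 0 := calc
    _ = ∑ f, ∑ g, ∑ σ, w σ * if f ∘ σ = g then altTensor ℚ f g else 0 := by
      refine sum_congr rfl fun f _ => sum_congr rfl fun g _ => ?_
      nth_rw 1 [hw f g]
      simp only [sum_mul, mul_assoc, ite_mul, one_mul, zero_mul]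
    _ = ∑ f, ∑ σ, w σ * altTensor ℚ f (f ∘ σ) := by
      refine sum_congr rfl fun f _ => ?_
      rw [sum_comm]
      simp only [mul_ite, mul_zero, sum_ite_eq, mem_univ, if_true]
    _ = ∑ σ, w σ * altTrace κ σ := by
      rw [sum_comm]
      simp only [altTrace, mul_sum]
    _ = 0 := by simp only [h, mul_zero, sum_const_zero]
  have hrow := (sum_eq_zero_iff_of_nonneg fun f _ => sum_nonneg fun g _ => mul_self_nonneg _).1
    hsquares Prod.fst (mem_univ _)
  have hentry := (sum_eq_zero_iff_of_nonneg fun g _ => mul_self_nonneg _).1 hrow Prod.snd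
    (mem_univ _)
  rw [altTensor_fst_snd, one_mul] at hentry
  exact one_ne_zero hentry

lemma centralizer_le_of_altTrace_ne_zero {π : Perm (κ × κ)} (h : altTrace κ π ≠ 0) :
    Subgroup.centralizer {π} ≤ alternatingGroup (κ × κ) := by
  intro τ hτ
  rw [Subgroup.mem_centralizer_singleton_iff] at hτ
  have hsign : altTrace κ π = ((Perm.sign τ : ℤ) : ℚ) * altTrace κ π := calc
    altTrace κ π = ∑ f : κ × κ → κ, altTensor ℚ (f ∘ τ) ((f ∘ τ) ∘ π) :=
      ((τ.symm.arrowCongr (Equiv.refl κ)).sum_comp _).symm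
    _ = ∑ f : κ × κ → κ, altTensor ℚ (f ∘ τ) ((f ∘ π) ∘ τ) := by
      simp only [Function.comp_assoc, ← Perm.coe_mul, hτ]
    _ = ((Perm.sign τ : ℤ) : ℚ) * altTrace κ π := by
      simp only [altTensor_comp, altTrace, mul_sum]
  rw [Perm.mem_alternatingGroup]
  refine (Int.units_eq_one_or _).resolve_right fun hneg => h ?_
  rw [hneg] at hsign
  push_cast at hsign
  linarith

end AlternatingTensor

section CycleTransversal

variable {α : Type*} {π : Perm α} {p : α → Prop}

/-- The points with property `p` form a system of representatives of the cycles of `π`, where a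
fixed point counts as a cycle. -/
def IsCycleTransversal (π : Perm α) (p : α → Prop) : Prop :=
  ∀ x, ∃! y, p y ∧ π.SameCycle y x

lemma exists_isCycleTransversal (π : Perm α) : ∃ p, IsCycleTransversal π p := by
  let q (x : α) : Quotient (Perm.SameCycle.setoid π) := Quotient.mk _ x
  refine ⟨fun x => (q x).out = x, fun x => ⟨(q x).out, ⟨?_, ?_⟩, ?_⟩⟩
  · simp only [q, Quotient.out_eq]
  · exact Quotient.exact (s := Perm.SameCycle.setoid π) (Quotient.out_eq _)
  · rintro y ⟨hy, hyx⟩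
    rw [← hy, show q y = q x from Quotient.sound hyx]

lemma IsCycleTransversal.eq_of_sameCycle (h : IsCycleTransversal π p) {x y : α} (hx : p x)
    (hy : p y) (hxy : π.SameCycle x y) : x = y :=
  (h y).unique ⟨hx, hxy⟩ ⟨hy, .rfl⟩

variable [Fintype α] [DecidableEq α]

lemma filter_sameCycle_of_apply_eq {x : α} (hx : π x = x) :
    univ.filter (π.SameCycle x) = {x} := by
  ext y
  simp only [mem_filter, mem_univ, true_and, mem_singleton]
  refine ⟨fun hy => (Perm.SameCycle.eq_of_left hy hx).symm, ?_⟩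
  rintro rfl
  exact .rfl

lemma filter_sameCycle_of_apply_ne {x : α} (hx : π x ≠ x) :
    univ.filter (π.SameCycle x) = (π.cycleOf x).support := by
  ext y
  rw [mem_filter, Perm.mem_support_cycleOf_iff, Perm.mem_support]
  simp only [mem_univ, true_and, hx, ne_eq, not_false_eq_true, and_true]

lemma card_filter_sameCycle_mem_cycleType {x : α} (hx : π x ≠ x) :
    #(univ.filter (π.SameCycle x)) ∈ π.cycleType := by
  rw [filter_sameCycle_of_apply_ne hx, Perm.cycleType_def]
  exact Multiset.mem_map_of_mem _
    (Perm.cycleOf_mem_cycleFactorsFinset_iff.2 (Perm.mem_support.2 hx))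

lemma odd_card_filter_sameCycle (h : Subgroup.centralizer {π} ≤ alternatingGroup α) (x : α) :
    Odd #(univ.filter (π.SameCycle x)) := by
  by_cases hx : π x = x
  · rw [filter_sameCycle_of_apply_eq hx, card_singleton]
    exact odd_one
  · exact (Perm.centralizer_le_alternating_iff.1 h).1 _ (card_filter_sameCycle_mem_cycleType hx)

lemma sameCycle_of_card_filter_eq (h : Subgroup.centralizer {π} ≤ alternatingGroup α) {x y : α}
    (hxy : #(univ.filter (π.SameCycle x)) = #(univ.filter (π.SameCycle y))) :
    π.SameCycle x y := by
  obtain ⟨-, hfix, hcount⟩ := Perm.centralizer_le_alternating_iff.1 h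
  by_cases hx : π x = x <;> by_cases hy : π y = y
  · by_contra hne
    have hpair : ({x, y} : Finset α) ⊆ π.supportᶜ := by simp [insert_subset_iff, hx, hy]
    have hcard := card_le_card hpair
    rw [card_pair (by rintro rfl; exact hne .rfl), card_compl] at hcard
    rw [Perm.sum_cycleType] at hfix
    omega
  · have := Perm.two_le_of_mem_cycleType (card_filter_sameCycle_mem_cycleType hy)
    rw [← hxy, filter_sameCycle_of_apply_eq hx, card_singleton] at this
    omega
  · have := Perm.two_le_of_mem_cycleType (card_filter_sameCycle_mem_cycleType hx)
    rw [hxy, filter_sameCycle_of_apply_eq hy, card_singleton] at this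
    omega
  · rw [filter_sameCycle_of_apply_ne hx, filter_sameCycle_of_apply_ne hy] at hxy
    have hnodup := Multiset.nodup_iff_count_le_one.2 hcount
    rw [Perm.cycleType_def] at hnodup
    have hcycle : π.cycleOf x = π.cycleOf y := Multiset.inj_on_of_nodup_map hnodup _
      (Perm.cycleOf_mem_cycleFactorsFinset_iff.2 (Perm.mem_support.2 hx)) _
      (Perm.cycleOf_mem_cycleFactorsFinset_iff.2 (Perm.mem_support.2 hy)) hxy
    have hmem : y ∈ (π.cycleOf x).support := by
      simpa [hcycle, Perm.mem_support_cycleOf_iff] using hy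
    exact (Perm.mem_support_cycleOf_iff.1 hmem).1

lemma card_sq_le_sum_of_odd {S : Finset ℕ} (hS : ∀ j ∈ S, Odd j) : #S ^ 2 ≤ ∑ j ∈ S, j := by
  induction S using Finset.induction_on_max with
  | empty => simp
  | insert a s ha ih =>
    have hsub : s ⊆ (range (a / 2)).image fun i => 2 * i + 1 := fun j hj => by
      obtain ⟨i, rfl⟩ := hS j (mem_insert_of_mem hj)
      exact mem_image_of_mem _ (mem_range.2 (by have := ha _ hj; omega))
    have hcard : #s ≤ a / 2 := (card_le_card hsub).trans (card_image_le.trans (card_range _).le)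
    have hodd := Nat.two_mul_div_two_add_one_of_odd (hS a (mem_insert_self a s))
    have hnotMem : a ∉ s := fun h => (ha a h).false
    rw [sum_insert hnotMem, card_insert_of_notMem hnotMem]
    nlinarith [ih fun j hj => hS j (mem_insert_of_mem hj)]

-- The lengths of the cycles are odd and distinct.
lemma IsCycleTransversal.card_sq_le (hp : IsCycleTransversal π p)
    (h : Subgroup.centralizer {π} ≤ alternatingGroup α) :
    Nat.card {x // p x} ^ 2 ≤ Fintype.card α := by
  classical
  let len (x : {x // p x}) : ℕ := #(univ.filter (π.SameCycle x))
  have hinj : Function.Injective len := fun x y hxy =>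
    Subtype.ext (hp.eq_of_sameCycle x.2 y.2 (sameCycle_of_card_filter_eq h hxy))
  choose r hr huniq using hp
  have hfiber (x : {x // p x}) :
      univ.filter (fun y => (⟨r y, (hr y).1⟩ : {x // p x}) = x) = univ.filter (π.SameCycle x) := by
    ext y
    simp only [mem_filter, mem_univ, true_and]
    refine ⟨fun hy => hy ▸ (hr y).2, fun hy => Subtype.ext ?_⟩
    exact (huniq y x ⟨x.2, hy⟩).symm
  calc Nat.card {x // p x} ^ 2
    _ = #(univ.image len) ^ 2 := by
      rw [card_image_of_injective _ hinj, card_univ, Nat.card_eq_fintype_card]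
    _ ≤ ∑ j ∈ univ.image len, j := card_sq_le_sum_of_odd fun j hj => by
      obtain ⟨x, -, rfl⟩ := mem_image.1 hj
      exact odd_card_filter_sameCycle h x
    _ = ∑ x, #(univ.filter fun y => (⟨r y, (hr y).1⟩ : {x // p x}) = x) := by
      rw [sum_image hinj.injOn]
      simp only [hfiber, len]
    _ = Fintype.card α := by
      rw [← card_eq_sum_card_fiberwise fun _ _ => mem_univ _, card_univ]

end CycleTransversal

section FullCycle

variable {α : Type*}

lemma apply_eq_of_sameCycle [Finite α] {β : Type*} {w : Perm α} {f : α → β} (hf : f ∘ w = f)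
    {x y : α} (h : w.SameCycle x y) : f x = f y := by
  obtain ⟨n, rfl⟩ := h.exists_nat_pow_eq
  clear h
  have hiterate : f ∘ w^[n] = f := by
    induction n with
    | zero => rfl
    | succ n ih => rw [Function.iterate_succ, ← Function.comp_assoc, ih, hf]
  rw [← Perm.iterate_eq_pow]
  exact (congrFun hiterate x).symm

-- Following `π * s` from `π x` on, the first moved point after `π x` is `x` itself.
lemma sameCycle_mul_apply [Finite α] {π s : Perm α}
    (hs : ∀ x y, π.SameCycle x y → s x ≠ x → s y ≠ y → x = y) (x : α) :
    (π * s).SameCycle (π x) x := by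
  by_cases hx : s x = x
  · simpa [hx] using Perm.sameCycle_apply_left.2 (Perm.SameCycle.refl (π * s) x)
  have hiterate (j : ℕ) (hj : j < Function.minimalPeriod π x) :
      (π * s).SameCycle (π x) (π^[j + 1] x) := by
    induction j with
    | zero => exact .rfl
    | succ j ih =>
      have hne : π^[j + 1] x ≠ x :=
        Function.not_isPeriodicPt_of_pos_of_lt_minimalPeriod j.succ_ne_zero hj
      have hfix : s (π^[j + 1] x) = π^[j + 1] x := by
        by_contra hmoved
        exact hne (hs _ _ ⟨(j + 1 : ℕ), by rw [zpow_natCast, Perm.iterate_eq_pow]⟩ hx hmoved).symm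
      have hstep : (π * s) (π^[j + 1] x) = π^[j + 1 + 1] x := by
        rw [Perm.mul_apply, hfix, ← Function.iterate_succ_apply' π]
      rw [← hstep, Perm.sameCycle_apply_right]
      exact ih (by omega)
  have hpos := Function.minimalPeriod_pos_of_mem_periodicPts
    (Function.Injective.mem_periodicPts π.injective x)
  simpa [Nat.sub_add_cancel hpos, Function.iterate_minimalPeriod] using
    hiterate (Function.minimalPeriod π x - 1) (by omega)

lemma exists_equiv_finRotate [Finite α] [Nonempty α] {w : Perm α} (hw : w.IsCycleOn Set.univ) :
    ∃ (m : ℕ) (e : Fin (m + 1) ≃ α), ∀ i, w (e i) = e (finRotate (m + 1) i) := by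
  have := Fintype.ofFinite α
  obtain ⟨m, hm⟩ := Nat.exists_eq_succ_of_ne_zero (Fintype.card_ne_zero (α := α))
  let a := Classical.arbitrary α
  have hw' : w.IsCycleOn (univ : Finset α) := by simpa using hw
  have hinj : Function.Injective fun i : Fin (m + 1) => (w ^ (i : ℕ)) a := fun i j hij => by
    rw [hw'.pow_apply_eq_pow_apply (mem_univ a), card_univ, hm] at hij
    exact Fin.ext (hij.eq_of_lt_of_lt i.2 j.2)
  let e := Equiv.ofBijective _ ((Fintype.bijective_iff_injective_and_card _).2 ⟨hinj, by simp [hm]⟩)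
  refine ⟨m, e, fun i => ?_⟩
  change w ((w ^ (i : ℕ)) a) = (w ^ (finRotate (m + 1) i : ℕ)) a
  rw [← Perm.mul_apply, ← pow_succ', hw'.pow_apply_eq_pow_apply (mem_univ a), card_univ, hm]
  induction i using Fin.lastCases with
  | last => simp
  | cast i => rw [finRotate_apply, Fin.coeSucc_eq_succ, Fin.val_succ, Fin.val_castSucc]

end FullCycle

section PartialTrace

variable {S T R : Type*} [Fintype S] [Fintype T] [CommRing R]

/-- The partial trace over the second factor. -/
def partialTrace (M : Matrix (S × T) (S × T) R) : Matrix S S R :=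
  Matrix.of fun a b => ∑ c, M (a, c) (b, c)

lemma partialTrace_commute [DecidableEq T] {M : Matrix (S × T) (S × T) R} {A : Matrix S S R}
    {B B' : Matrix T T R} (hB : B' * B = 1) (h : Commute M (Matrix.kroneckerMap (· * ·) A B)) :
    Commute (partialTrace M) A := by
  let block (a b : S) : Matrix T T R := Matrix.of fun c d => M (a, c) (b, d)
  have htrace (a b : S) : partialTrace M a b = (block a b).trace := rfl
  have hblock (a b : S) :
      ∑ x, A x b • (block a x * B) = ∑ x, A a x • (B * block x b) := by
    ext c d
    have hentry := congrFun (congrFun h.eq (a, c)) (b, d)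
    simp only [Matrix.mul_apply, Matrix.kroneckerMap_apply, Fintype.sum_prod_type] at hentry
    simpa only [Matrix.sum_apply, Matrix.smul_apply, Matrix.mul_apply, smul_eq_mul, mul_sum, block,
      Matrix.of_apply, mul_assoc, mul_left_comm] using hentry
  ext a b
  simp only [Matrix.mul_apply, htrace]
  calc ∑ x, (block a x).trace * A x b
    _ = ((∑ x, A x b • (block a x * B)) * B').trace := by
      simp only [sum_mul, Matrix.trace_sum, smul_mul_assoc, Matrix.trace_smul, mul_assoc,
        mul_eq_one_comm.1 hB, mul_one, smul_eq_mul, mul_comm]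
    _ = ((∑ x, A a x • (B * block x b)) * B').trace := by rw [hblock]
    _ = ∑ x, A a x * (block x b).trace := by
      simp only [sum_mul, Matrix.trace_sum, smul_mul_assoc, Matrix.trace_smul, smul_eq_mul]
      refine sum_congr rfl fun x _ => ?_
      rw [Matrix.trace_mul_comm, ← mul_assoc, hB, one_mul]

end PartialTrace

section Contraction

variable {κ ι : Type*} {p : ι → Prop} [DecidablePred p]

/-- The function on all points given by a function on the points with property `p` and a function
on the others. -/
def glue (a : {x // p x} → κ) (c : {x // ¬ p x} → κ) : ι → κ :=
  (Equiv.piEquivPiSubtypeProd p fun _ => κ).symm (a, c)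

lemma glue_of_pos (a : {x // p x} → κ) (c : {x // ¬ p x} → κ) {x : ι} (hx : p x) :
    glue a c x = a ⟨x, hx⟩ := by
  simp [glue, Equiv.piEquivPiSubtypeProd, hx]

lemma glue_of_neg (a : {x // p x} → κ) (c : {x // ¬ p x} → κ) {x : ι} (hx : ¬ p x) :
    glue a c x = c ⟨x, hx⟩ := by
  simp [glue, Equiv.piEquivPiSubtypeProd, hx]

variable {R : Type*} [CommRing R] [Fintype ι]

lemma kroneckerFamily_glue (x : ι → Matrix κ κ R) (a b : {x // p x} → κ) (c d : {x // ¬ p x} → κ) :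
    kroneckerFamily x (glue a c) (glue b d) =
      kroneckerFamily (fun i : {x // p x} => x i) a b *
        kroneckerFamily (fun i : {x // ¬ p x} => x i) c d := by
  simp only [kroneckerFamily_apply]
  rw [← Fintype.prod_subtype_mul_prod_subtype p]
  congr 1
  · exact prod_congr rfl fun i _ => by rw [glue_of_pos _ _ i.2, glue_of_pos _ _ i.2]
  · exact prod_congr rfl fun i _ => by rw [glue_of_neg _ _ i.2, glue_of_neg _ _ i.2]

variable [Fintype κ] [DecidableEq ι]

lemma sum_glue {N : Type*} [AddCommMonoid N] (p : ι → Prop) [DecidablePred p] (F : (ι → κ) → N) :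
    ∑ f, F f = ∑ a : {x // p x} → κ, ∑ c : {x // ¬ p x} → κ, F (glue a c) := by
  rw [← (Equiv.piEquivPiSubtypeProd p fun _ => κ).symm.sum_comp, Fintype.sum_prod_type]
  rfl

/-- The contraction of a matrix on a tensor power in the factors without the property `p`. -/
def contract (p : ι → Prop) [DecidablePred p] (M : Matrix (ι → κ) (ι → κ) R) :
    Matrix ({x // p x} → κ) ({x // p x} → κ) R :=
  Matrix.of fun a b => ∑ c, M (glue a c) (glue b c)

variable [DecidableEq κ]

lemma contract_commute (p : ι → Prop) [DecidablePred p] {M : Matrix (ι → κ) (ι → κ) R}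
    {g : Matrix κ κ R} (hg : IsUnit g.det) (h : Commute M (kroneckerFamily fun _ => g)) :
    Commute (contract p M) (kroneckerFamily fun _ => g) := by
  have hinv : (kroneckerFamily fun _ : {x // ¬ p x} => g⁻¹) * (kroneckerFamily fun _ => g) = 1 := by
    rw [kroneckerFamily_mul]
    simp only [Matrix.nonsing_inv_mul g hg, kroneckerFamily_one]
  let E := (Equiv.piEquivPiSubtypeProd p fun _ => κ).symm
  have hE : (kroneckerFamily fun _ : ι => g).submatrix E E = Matrix.kroneckerMap (· * ·)
      (kroneckerFamily fun _ : {x // p x} => g) (kroneckerFamily fun _ : {x // ¬ p x} => g) := by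
    ext u v
    exact kroneckerFamily_glue _ _ _ _ _
  refine partialTrace_commute (M := M.submatrix E E) hinv ?_
  rw [← hE, Commute, SemiconjBy, Matrix.submatrix_mul_equiv, Matrix.submatrix_mul_equiv, h.eq]

/-- The alternating tensor, multiplied by `π` and contracted in the factors without the
property `p`. -/
def contractedTensor (π : Perm (κ × κ)) (p : κ × κ → Prop) [DecidablePred p] :
    Matrix ({x // p x} → κ) ({x // p x} → κ) ℚ :=
  contract p ((altTensor ℚ).submatrix (· ∘ π.symm) id)

lemma contractedTensor_commute (π : Perm (κ × κ)) (p : κ × κ → Prop) [DecidablePred p]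
    {g : Matrix κ κ ℚ} (hg : IsUnit g.det) :
    Commute (contractedTensor π p) (kroneckerFamily fun _ => g) := by
  refine contract_commute p hg ?_
  ext f h
  have hcomm := congrFun (congrFun (altTensor_commute g).eq (f ∘ π.symm)) h
  simp only [Matrix.mul_apply, Matrix.submatrix_apply, id] at hcomm ⊢
  rw [hcomm, ← (π.arrowCongr (Equiv.refl κ)).sum_comp]
  refine sum_congr rfl fun k _ => congrArg (· * _) ?_
  simp only [kroneckerFamily_apply]
  rw [← Equiv.prod_comp π]
  simp only [Function.comp_apply, symm_apply_apply, arrowCongr_apply, refl_apply]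

lemma sum_contractedTensor (π : Perm (κ × κ)) (p : κ × κ → Prop) [DecidablePred p]
    (s : Perm {x // p x}) :
    ∑ a, contractedTensor π p a (a ∘ s) = altTrace κ (π * Perm.ofSubtype s) := by
  rw [altTrace, ← (π.arrowCongr (Equiv.refl κ)).sum_comp, sum_glue p]
  refine sum_congr rfl fun a _ => sum_congr rfl fun c _ => congrArg (altTensor ℚ _) ?_
  ext x
  simp only [id, Function.comp_apply, Perm.mul_apply, arrowCongr_apply, refl_apply,
    symm_apply_apply]
  by_cases hx : p x
  · rw [glue_of_pos _ _ hx, Perm.ofSubtype_apply_of_mem s hx, glue_of_pos _ _ (s ⟨x, hx⟩).2]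
    rfl
  · rw [glue_of_neg _ _ hx, Perm.ofSubtype_apply_of_not_mem s hx, glue_of_neg _ _ hx]

end Contraction

section FullCycleTrace

lemma numInvariant_mul_ofSubtype_lt {α : Type*} [Finite α] {π : Perm α} {p : α → Prop}
    [DecidablePred p] (hp : IsCycleTransversal π p) {s : Perm {x // p x}} (hs : s ≠ 1) :
    numInvariant Bool (π * Perm.ofSubtype s) < numInvariant Bool π := by
  classical
  have hmoved (x : α) (hx : Perm.ofSubtype s x ≠ x) : p x := by
    by_contra hpx
    exact hx (Perm.ofSubtype_apply_of_not_mem s hpx)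
  refine Set.ncard_lt_ncard (Set.ssubset_iff_of_subset (fun f hf => ?_) |>.2 ?_)
  · ext x
    exact apply_eq_of_sameCycle hf (sameCycle_mul_apply (fun x y hxy hx hy =>
      hp.eq_of_sameCycle (hmoved x hx) (hmoved y hy) hxy) x)
  · obtain ⟨x, hx⟩ : ∃ x, s x ≠ x := by
      by_contra! h
      exact hs (Equiv.ext h)
    refine ⟨fun y => decide (π.SameCycle x y), ?_, fun hf => hx ?_⟩
    · ext y
      simp only [Function.comp_apply, Perm.sameCycle_apply_right]
    · have hvalue := congrFun hf x
      simp only [Function.comp_apply, Perm.mul_apply, Perm.ofSubtype_apply_coe,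
        Perm.sameCycle_apply_right, decide_eq_decide] at hvalue
      exact Subtype.ext
        (hp.eq_of_sameCycle (s x).2 x.2 (hvalue.2 (Perm.SameCycle.refl _ _)).symm)

-- A permutation with the least number of cycles among those with nonzero trace does it: multiplying
-- it by a permutation of a transversal merges cycles.
lemma exists_sum_contractedTensor_eq_ite (κ : Type*) [Fintype κ] [DecidableEq κ] :
    ∃ (π : Perm (κ × κ)) (p : κ × κ → Prop) (_ : DecidablePred p), IsCycleTransversal π p ∧
      Nat.card {x // p x} ≤ Nat.card κ ∧ ∃ c : ℚ, c ≠ 0 ∧ ∀ s : Perm {x // p x},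
        ∑ a, contractedTensor π p a (a ∘ s) = if s = 1 then c else 0 := by
  classical
  obtain ⟨π₁, hπ₁⟩ := exists_altTrace_ne_zero κ
  obtain ⟨π, hπ, hmin⟩ := exists_min_image
    (univ.filter fun π : Perm (κ × κ) => altTrace κ π ≠ 0) (numInvariant Bool)
    ⟨π₁, by simpa using hπ₁⟩
  simp only [mem_filter, mem_univ, true_and] at hπ hmin
  obtain ⟨p, hp⟩ := exists_isCycleTransversal π
  refine ⟨π, p, inferInstance, hp, ?_, altTrace κ π, hπ, fun s => ?_⟩
  · have hsq := hp.card_sq_le (centralizer_le_of_altTrace_ne_zero hπ)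
    rw [Fintype.card_prod, ← sq, ← Nat.card_eq_fintype_card] at hsq
    exact (Nat.pow_le_pow_iff_left two_ne_zero).1 hsq
  · rw [sum_contractedTensor]
    split_ifs with hs
    · rw [hs, map_one, mul_one]
    · by_contra hne
      exact (numInvariant_mul_ofSubtype_lt hp hs).not_ge (hmin _ hne)

lemma sum_mul_apply_comp_ne_zero {ι κ : Type*} [Fintype ι] [DecidableEq ι] [Fintype κ]
    [DecidableEq κ] (hι : Fintype.card ι ≤ Nat.card κ) {M : Matrix (ι → κ) (ι → κ) ℚ}
    (hM : ∀ g : Matrix κ κ ℚ, IsUnit g.det → Commute M (kroneckerFamily fun _ => g))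
    {c : ℚ} (hc : c ≠ 0) (htrace : ∀ s : Perm ι, ∑ a, M a (a ∘ s) = if s = 1 then c else 0)
    (ρ : Perm ι) : ∑ a, ∑ b, M a b * M b (a ∘ ρ) ≠ 0 := by
  obtain ⟨w, hw⟩ := exists_perm_coeff hM
  have hw0 : w ρ ≠ 0 := by
    refine weingarten_ne_zero (κ := κ) hι hc (fun τ => ?_) ρ
    rw [← htrace τ]
    simp_rw [hw]
    symm
    rw [sum_comm, ← Equiv.sum_comp (Equiv.mulRight τ)]
    refine sum_congr rfl fun g _ => ?_
    rw [← mul_sum, coe_mulRight, sum_boole, numInvariant, Nat.card_eq_fintype_card,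
      Fintype.card_subtype]
    refine congrArg (fun k : ℕ => w (g * τ) * (k : ℚ)) (congrArg Finset.card ?_)
    refine filter_congr fun a _ => ?_
    rw [Perm.coe_mul, ← Function.comp_assoc]
    exact τ.surjective.right_cancellable
  have hM' (a b : ι → κ) :
      M b (a ∘ ρ) = ∑ s, w s * if b = a ∘ (ρ * s⁻¹ : Perm ι) then 1 else 0 := by
    rw [hw]
    refine sum_congr rfl fun s _ => ?_
    rw [Perm.coe_mul, ← Function.comp_assoc, Perm.coe_inv]
    simp only [eq_comp_symm]
  suffices h : ∑ a, ∑ b, M a b * M b (a ∘ ρ) = w ρ * c from h ▸ mul_ne_zero hw0 hc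
  calc ∑ a, ∑ b, M a b * M b (a ∘ ρ)
    _ = ∑ a, ∑ s, w s * M a (a ∘ (ρ * s⁻¹ : Perm ι)) := by
      refine sum_congr rfl fun a _ => ?_
      simp_rw [hM', mul_sum]
      rw [sum_comm]
      simp only [mul_ite, mul_one, mul_zero, sum_ite_eq', mem_univ, if_true, mul_comm]
    _ = ∑ s, w s * if s = ρ then c else 0 := by
      rw [sum_comm]
      simp_rw [← mul_sum, htrace, mul_inv_eq_one, eq_comm (a := ρ)]
    _ = w ρ * c := by
      simp only [mul_ite, mul_zero, sum_ite_eq', mem_univ, if_true]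

section JoinedPerm

variable {α : Type*} {π : Perm α} {p : α → Prop} [DecidablePred p]

/-- The permutation of `α ⊕ α` that interchanges the two copies of the points with property `p`. -/
def swapCopies (p : α → Prop) [DecidablePred p] : Perm (α ⊕ α) :=
  Function.Involutive.toPerm
    (Sum.elim (fun x => if p x then Sum.inr x else Sum.inl x)
      (fun x => if p x then Sum.inl x else Sum.inr x))
    (by rintro (x | x) <;> by_cases hx : p x <;> simp [hx])

lemma swapCopies_inl (x : α) :
    swapCopies p (Sum.inl x) = if p x then Sum.inr x else Sum.inl x := rfl

lemma swapCopies_inr (x : α) :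
    swapCopies p (Sum.inr x) = if p x then Sum.inl x else Sum.inr x := rfl

/-- The permutation of `α ⊕ α` that interchanges the two copies of the points with property `p` and
then moves those in the first copy by `ρ`. -/
def junction (ρ : Perm {x // p x}) : Perm (α ⊕ α) :=
  Perm.sumCongr (Perm.ofSubtype ρ) 1 * swapCopies p

lemma junction_inl (ρ : Perm {x // p x}) {x : α} (hx : p x) :
    junction ρ (Sum.inl x) = Sum.inr x := by
  simp [junction, swapCopies_inl, hx]

lemma junction_inr (ρ : Perm {x // p x}) {x : α} (hx : p x) :
    junction ρ (Sum.inr x) = Sum.inl (ρ ⟨x, hx⟩ : α) := by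
  simp [junction, swapCopies_inr, hx, Perm.ofSubtype_apply_of_mem ρ hx]

lemma junction_inl_of_not (ρ : Perm {x // p x}) {x : α} (hx : ¬ p x) :
    junction ρ (Sum.inl x) = Sum.inl x := by
  simp [junction, swapCopies_inl, hx, Perm.ofSubtype_apply_of_not_mem ρ hx]

lemma junction_inr_of_not (ρ : Perm {x // p x}) {x : α} (hx : ¬ p x) :
    junction ρ (Sum.inr x) = Sum.inr x := by
  simp [junction, swapCopies_inr, hx]

/-- Two copies of `π`, joined along the points with property `p`. -/
def joinedPerm (π : Perm α) (ρ : Perm {x // p x}) : Perm (α ⊕ α) :=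
  Perm.sumCongr π π * junction ρ

lemma sumCongr_zpow (π : Perm α) (k : ℤ) :
    Perm.sumCongr π π ^ k = Perm.sumCongr (π ^ k) (π ^ k) :=
  (map_zpow (Perm.sumCongrHom α α) (π, π) k).symm

lemma eq_of_sameCycle_sumCongr (hp : IsCycleTransversal π p) (ρ : Perm {x // p x}) {x y : α ⊕ α}
    (hxy : (Perm.sumCongr π π).SameCycle x y) (hx : junction ρ x ≠ x) (hy : junction ρ y ≠ y) :
    x = y := by
  obtain ⟨k, hk⟩ := hxy
  rw [sumCongr_zpow] at hk
  rcases x with x | x <;> rcases y with y | y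
  · exact congrArg Sum.inl (hp.eq_of_sameCycle (not_imp_comm.1 (junction_inl_of_not ρ) hx)
      (not_imp_comm.1 (junction_inl_of_not ρ) hy) ⟨k, Sum.inl_injective hk⟩)
  · exact absurd hk Sum.inl_ne_inr
  · exact absurd hk Sum.inr_ne_inl
  · exact congrArg Sum.inr (hp.eq_of_sameCycle (not_imp_comm.1 (junction_inr_of_not ρ) hx)
      (not_imp_comm.1 (junction_inr_of_not ρ) hy) ⟨k, Sum.inr_injective hk⟩)

lemma joinedPerm_isCycleOn [Finite α] (hp : IsCycleTransversal π p) {ρ : Perm {x // p x}}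
    (hρ : ρ.IsCycleOn Set.univ) : (joinedPerm π ρ).IsCycleOn Set.univ := by
  let cycle (x : α ⊕ α) : Quotient (Perm.SameCycle.setoid (joinedPerm π ρ)) := Quotient.mk _ x
  have hcopies (x : α ⊕ α) : cycle (Perm.sumCongr π π x) = cycle x :=
    Quotient.sound (sameCycle_mul_apply (fun _ _ => eq_of_sameCycle_sumCongr hp ρ) x)
  have hjunction (x : α ⊕ α) : cycle (junction ρ x) = cycle x := by
    rw [← hcopies]
    exact Quotient.sound (Perm.sameCycle_apply_left.2 (.refl (joinedPerm π ρ) x))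
  have hinl {x y : α} (h : π.SameCycle x y) : cycle (Sum.inl x) = cycle (Sum.inl y) :=
    apply_eq_of_sameCycle (f := cycle ∘ Sum.inl) (funext fun x => hcopies (Sum.inl x)) h
  have hinr {x y : α} (h : π.SameCycle x y) : cycle (Sum.inr x) = cycle (Sum.inr y) :=
    apply_eq_of_sameCycle (f := cycle ∘ Sum.inr) (funext fun x => hcopies (Sum.inr x)) h
  have hswap {x : α} (hx : p x) : cycle (Sum.inr x) = cycle (Sum.inl x) := by
    rw [← junction_inl ρ hx, hjunction]
  have htransversal (x y : {x // p x}) : cycle (Sum.inl x) = cycle (Sum.inl y) := by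
    refine apply_eq_of_sameCycle (f := fun x : {x // p x} => cycle (Sum.inl x))
      (funext fun x => ?_) (hρ.2 (Set.mem_univ x) (Set.mem_univ y))
    rw [Function.comp_apply, ← junction_inr ρ x.2, hjunction, hswap x.2]
  have hrepresentative (x : α ⊕ α) : ∃ y : {x // p x}, cycle x = cycle (Sum.inl y) := by
    rcases x with x | x <;> obtain ⟨y, ⟨hy, hyx⟩, -⟩ := hp x
    · exact ⟨⟨y, hy⟩, (hinl hyx).symm⟩
    · exact ⟨⟨y, hy⟩, (hinr hyx).symm.trans (hswap hy)⟩
  refine ⟨(joinedPerm π ρ).bijective.bijOn_univ, fun x _ y _ => ?_⟩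
  obtain ⟨x', hx⟩ := hrepresentative x
  obtain ⟨y', hy⟩ := hrepresentative y
  exact Quotient.exact (hx.trans ((htransversal x' y').trans hy.symm))

end JoinedPerm

variable {κ : Type*} [Fintype κ] [DecidableEq κ]

/-- The doubly alternating trace along a permutation of two copies of the positions. -/
def doubleAltTrace (κ : Type*) [Fintype κ] [DecidableEq κ] (w : Perm (κ × κ ⊕ κ × κ)) : ℚ :=
  ∑ h : κ × κ ⊕ κ × κ → κ, altTensor ℚ (fun i => h (Sum.inl i)) (fun i => h (w (Sum.inl i))) *
    altTensor ℚ (fun i => h (Sum.inr i)) (fun i => h (w (Sum.inr i)))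

lemma doubleAltTrace_joinedPerm (π : Perm (κ × κ)) {p : κ × κ → Prop} [DecidablePred p]
    (ρ : Perm {x // p x}) : doubleAltTrace κ (joinedPerm π ρ) =
      ∑ a, ∑ b, contractedTensor π p a b * contractedTensor π p b (a ∘ ρ) := by
  let pair (f g : κ × κ → κ) : κ × κ ⊕ κ × κ → κ := Sum.elim (f ∘ π.symm) (g ∘ π.symm)
  have hsum (F : (κ × κ ⊕ κ × κ → κ) → ℚ) : ∑ h, F h = ∑ f, ∑ g, F (pair f g) := by
    rw [← (((π.arrowCongr (Equiv.refl κ)).prodCongr (π.arrowCongr (Equiv.refl κ))).trans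
      (sumArrowEquivProdArrow _ _ _).symm).sum_comp, Fintype.sum_prod_type]
    rfl
  have hinl (a b : {x // p x} → κ) (c d : {x // ¬ p x} → κ) :
      (fun i => pair (glue a c) (glue b d) (joinedPerm π ρ (Sum.inl i))) = glue b c := by
    ext i
    by_cases hi : p i
    · simp [pair, joinedPerm, junction_inl, hi, glue_of_pos]
    · simp [pair, joinedPerm, junction_inl_of_not, hi, glue_of_neg]
  have hinr (a b : {x // p x} → κ) (c d : {x // ¬ p x} → κ) :
      (fun i => pair (glue a c) (glue b d) (joinedPerm π ρ (Sum.inr i))) = glue (a ∘ ρ) d := by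
    ext i
    by_cases hi : p i
    · simp [pair, joinedPerm, junction_inr ρ hi, hi, glue_of_pos, (ρ ⟨i, hi⟩).2]
    · simp [pair, joinedPerm, junction_inr_of_not, hi, glue_of_neg]
  rw [doubleAltTrace, hsum, sum_glue p]
  refine sum_congr rfl fun a _ => ?_
  simp_rw [sum_glue p (fun _ : κ × κ → κ => _), hinl, hinr]
  rw [sum_comm]
  refine sum_congr rfl fun b _ => ?_
  simp only [contractedTensor, contract, Matrix.of_apply, sum_mul_sum]
  rfl

theorem exists_doubleAltTrace_ne_zero (κ : Type*) [Fintype κ] [DecidableEq κ] :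
    ∃ w : Perm (κ × κ ⊕ κ × κ), w.IsCycleOn Set.univ ∧ doubleAltTrace κ w ≠ 0 := by
  obtain ⟨π, p, _, hp, hcard, c, hc, htrace⟩ := exists_sum_contractedTensor_eq_ite κ
  obtain ⟨ρ, hρ, -⟩ := Finset.exists_cycleOn (univ : Finset {x // p x})
  refine ⟨joinedPerm π ρ, joinedPerm_isCycleOn hp (by simpa using hρ), ?_⟩
  rw [doubleAltTrace_joinedPerm]
  rw [Nat.card_eq_fintype_card] at hcard
  exact sum_mul_apply_comp_ne_zero hcard (fun _ => contractedTensor_commute π p) hc htrace ρ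

end FullCycleTrace

section MatrixProducts

variable {κ R : Type*} [Fintype κ] [DecidableEq κ] [CommRing R]

lemma prod_ofFn_apply {m : ℕ} (z : Fin m → Matrix κ κ R) (a b : κ) :
    (List.ofFn z).prod a b = ∑ h : Fin (m + 1) → κ,
      (if h 0 = a ∧ h (Fin.last m) = b then 1 else 0) * ∏ i, z i (h i.castSucc) (h i.succ) := by
  have hcons (m : ℕ) (F : (Fin (m + 1) → κ) → R) : ∑ h, F h = ∑ x, ∑ h, F (Fin.cons x h) := by
    rw [← (Fin.consEquiv fun _ => κ).sum_comp, Fintype.sum_prod_type]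
    rfl
  induction m generalizing a with
  | zero =>
    simp [hcons, Matrix.one_apply, ite_and]
  | succ m ih =>
    simp only [List.ofFn_succ, List.prod_cons, Matrix.mul_apply, ih, mul_sum, hcons (m + 1)]
    rw [sum_comm, sum_comm (s := univ (α := κ))]
    refine sum_congr rfl fun h _ => ?_
    simp [ite_and, Fin.prod_univ_succ, ← Fin.succ_last]

lemma trace_prod_ofFn {m : ℕ} (z : Fin (m + 1) → Matrix κ κ R) :
    (List.ofFn z).prod.trace = ∑ h : Fin (m + 1) → κ, ∏ i, z i (h i) (h (finRotate (m + 1) i)) := by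
  have hzero (h : Fin (m + 1) → κ) (x : κ) : (Fin.snoc h x : Fin (m + 2) → κ) 0 = h 0 :=
    Fin.snoc_castSucc (i := 0) ..
  have hsucc (h : Fin (m + 1) → κ) (i : Fin (m + 1)) :
      (Fin.snoc h (h 0) : Fin (m + 2) → κ) i.succ = h (finRotate (m + 1) i) := by
    refine Fin.lastCases ?_ (fun i => ?_) i
    · simp
    · rw [Fin.succ_castSucc, Fin.snoc_castSucc, finRotate_apply, Fin.coeSucc_eq_succ]
  simp only [Matrix.trace, Matrix.diag_apply, prod_ofFn_apply]
  rw [sum_comm, ← (Fin.snocEquiv fun _ => κ).sum_comp, Fintype.sum_prod_type, sum_comm]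
  refine sum_congr rfl fun h _ => ?_
  simp [hzero, hsucc, ite_and, -finRotate_apply]

end MatrixProducts

section RegevSum

/-- The sum over all permutations of the variables of both kinds, with signs, of the values of a
word in two sets of variables. -/
def regevSum {ι B : Type*} [Fintype ι] [DecidableEq ι] [Ring B] (word : List (ι ⊕ ι))
    (x y : ι → B) : B :=
  ∑ σ : Perm ι, ∑ τ : Perm ι, ((Perm.sign σ : ℤ) * (Perm.sign τ : ℤ)) •
    (word.map (Sum.elim (x ∘ σ) (y ∘ τ))).prod

section General

variable {ι B : Type*} [Fintype ι] [DecidableEq ι] [Ring B]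

lemma map_regevSum {C : Type*} [Ring C] (f : B →+* C) (word : List (ι ⊕ ι)) (x y : ι → B) :
    f (regevSum word x y) = regevSum word (f ∘ x) (f ∘ y) := by
  simp only [regevSum, map_sum, map_zsmul, map_list_prod, List.map_map, Sum.comp_elim,
    Function.comp_assoc]

lemma regevSum_conj (word : List (ι ⊕ ι)) (x y : ι → B) (u : Bˣ) :
    regevSum word (fun i => u * x i * (u⁻¹ : Bˣ)) (fun i => u * y i * (u⁻¹ : Bˣ)) =
      u * regevSum word x y * (u⁻¹ : Bˣ) :=
  (map_regevSum (MulSemiringAction.toRingHom (ConjAct Bˣ) B (ConjAct.toConjAct u)) word x y).symm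

end General

variable {κ R : Type*} [Fintype κ] [DecidableEq κ] [CommRing R]

lemma sum_sign_prod_sum (x y : κ × κ → Matrix κ κ R) {H : Type*} [Fintype H] (c : H → R)
    (f g : H → κ × κ ⊕ κ × κ → κ) :
    ∑ σ : Perm (κ × κ), ∑ τ : Perm (κ × κ), ((Perm.sign σ : ℤ) * (Perm.sign τ : ℤ) : R) *
      ∑ h, c h * ∏ j, (Sum.elim (x ∘ σ) (y ∘ τ) : _ → Matrix κ κ R) j (f h j) (g h j) =
    (coordMatrix x).det * (coordMatrix y).det * ∑ h, c h *
      (altTensor R (fun i => f h (Sum.inl i)) (fun i => g h (Sum.inl i)) *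
        altTensor R (fun i => f h (Sum.inr i)) (fun i => g h (Sum.inr i))) := by
  simp_rw [mul_sum, sum_comm (t := (univ : Finset H))]
  refine sum_congr rfl fun h _ => ?_
  rw [mul_left_comm, mul_mul_mul_comm, ← sum_sign_prod_eq, ← sum_sign_prod_eq, sum_mul_sum, mul_sum]
  refine sum_congr rfl fun σ _ => ?_
  rw [mul_sum]
  refine sum_congr rfl fun τ _ => ?_
  simp only [Fintype.prod_sum_type, Sum.elim_inl, Sum.elim_inr, Function.comp_apply]
  ring

lemma regevSum_ofFn_apply {m : ℕ} (e : Fin m ≃ κ × κ ⊕ κ × κ) (x y : κ × κ → Matrix κ κ R)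
    (a b : κ) : regevSum (List.ofFn e) x y a b =
      (coordMatrix x).det * (coordMatrix y).det * ∑ h : Fin (m + 1) → κ,
        (if h 0 = a ∧ h (Fin.last m) = b then 1 else 0) *
        (altTensor R (fun i => h (e.symm (Sum.inl i)).castSucc)
            (fun i => h (e.symm (Sum.inl i)).succ) *
          altTensor R (fun i => h (e.symm (Sum.inr i)).castSucc)
            (fun i => h (e.symm (Sum.inr i)).succ)) := by
  have hreindex (z : κ × κ ⊕ κ × κ → Matrix κ κ R) (h : Fin (m + 1) → κ) :
      ∏ i, z (e i) (h i.castSucc) (h i.succ) =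
        ∏ j, z j (h (e.symm j).castSucc) (h (e.symm j).succ) := by
    simp [← e.prod_comp]
  refine Eq.trans ?_ (sum_sign_prod_sum x y
    (fun h : Fin (m + 1) → κ => if h 0 = a ∧ h (Fin.last m) = b then 1 else 0)
    (fun h j => h (e.symm j).castSucc) (fun h j => h (e.symm j).succ))
  simp only [regevSum, Matrix.sum_apply, Matrix.smul_apply, List.map_ofFn, prod_ofFn_apply,
    Function.comp_apply, hreindex]
  simp only [zsmul_eq_mul, Int.cast_mul]

lemma regevSum_eq_smul {m : ℕ} (e : Fin m ≃ κ × κ ⊕ κ × κ) (x y : κ × κ → Matrix κ κ R) :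
    regevSum (List.ofFn e) x y = ((coordMatrix x).det * (coordMatrix y).det) •
      regevSum (List.ofFn e) (matrixUnit R) (matrixUnit R) := by
  ext a b
  rw [Matrix.smul_apply, regevSum_ofFn_apply, regevSum_ofFn_apply, coordMatrix_matrixUnit,
    Matrix.det_one, one_mul, one_mul, smul_eq_mul]

lemma trace_regevSum_matrixUnit {m : ℕ} {e : Fin (m + 1) ≃ κ × κ ⊕ κ × κ}
    {w : Perm (κ × κ ⊕ κ × κ)} (hw : ∀ i, w (e i) = e (finRotate (m + 1) i)) :
    (regevSum (List.ofFn e) (matrixUnit ℚ) (matrixUnit ℚ)).trace = doubleAltTrace κ w := by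
  have hreindex (z : κ × κ ⊕ κ × κ → Matrix κ κ ℚ) :
      ∑ h : Fin (m + 1) → κ, ∏ i, z (e i) (h i) (h (finRotate (m + 1) i)) =
        ∑ h : κ × κ ⊕ κ × κ → κ, ∏ j, z j (h j) (h (w j)) := by
    rw [← (e.arrowCongr (Equiv.refl κ)).sum_comp]
    simp [← e.prod_comp, hw]
  have hsum := sum_sign_prod_sum (matrixUnit ℚ) (matrixUnit ℚ)
    (fun _ : κ × κ ⊕ κ × κ → κ => 1) (fun h => h) (fun h j => h (w j))
  simp only [coordMatrix_matrixUnit, Matrix.det_one, one_mul] at hsum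
  rw [doubleAltTrace, ← hsum]
  simp only [regevSum, Matrix.trace_sum, Matrix.trace_smul, List.map_ofFn, trace_prod_ofFn,
    Function.comp_apply, hreindex]
  simp only [zsmul_eq_mul, Int.cast_mul]

-- Conjugating all variables by a transvection conjugates the value, and multiplies it by the
-- determinants of the coordinate matrices, which are `1`.
lemma regevSum_matrixUnit_mem_range_scalar {m : ℕ} (e : Fin m ≃ κ × κ ⊕ κ × κ) :
    regevSum (List.ofFn e) (matrixUnit R) (matrixUnit R) ∈ Set.range (Matrix.scalar κ) := by
  refine Matrix.mem_range_scalar_of_commute_transvectionStruct fun t => ?_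
  let u : (Matrix κ κ R)ˣ := ⟨t.toMatrix, t.inv.toMatrix, t.mul_inv, t.inv_mul⟩
  have hconj := regevSum_conj (List.ofFn e) (matrixUnit R) (matrixUnit R) u
  rw [regevSum_eq_smul, coordMatrix_mul_matrixUnit_mul, Matrix.det_kronecker,
    Matrix.det_transpose] at hconj
  simp only [u, Units.inv_mk, Matrix.TransvectionStruct.det, one_pow, one_mul, one_smul] at hconj
  exact ((Units.eq_mul_inv_iff_mul_eq u).1 hconj).symm

lemma regevSum_matrixUnit_ne_zero (F : Type*) [Field F] [CharZero F] {m : ℕ}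
    {e : Fin (m + 1) ≃ κ × κ ⊕ κ × κ} {w : Perm (κ × κ ⊕ κ × κ)}
    (hw : ∀ i, w (e i) = e (finRotate (m + 1) i)) (htrace : doubleAltTrace κ w ≠ 0) :
    regevSum (List.ofFn e) (matrixUnit F) (matrixUnit F) ≠ 0 := by
  have hmap := map_regevSum (algebraMap ℚ F).mapMatrix (List.ofFn e) (matrixUnit ℚ) (matrixUnit ℚ)
  have hunit : (algebraMap ℚ F).mapMatrix ∘ matrixUnit ℚ =
      (matrixUnit F : κ × κ → Matrix κ κ F) := by
    ext1 i
    simp [matrixUnit]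
  rw [hunit] at hmap
  rw [← hmap, map_ne_zero_iff _ (Matrix.map_injective (algebraMap ℚ F).injective)]
  intro hzero
  rw [← trace_regevSum_matrixUnit hw, hzero, Matrix.trace_zero] at htrace
  exact htrace rfl

lemma det_coordMatrix_ne_zero {F : Type*} [Field F] {b : κ × κ → Matrix κ κ F}
    (hb : LinearIndependent F b) : (coordMatrix b).det ≠ 0 := by
  rw [← isUnit_iff_ne_zero, ← Matrix.isUnit_iff_isUnit_det,
    ← Matrix.linearIndependent_rows_iff_isUnit]
  exact hb.map' (LinearMap.pi fun p : κ × κ => Matrix.entryLinearMap F F p.1 p.2)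
    (LinearMap.ker_eq_bot.2 fun M N h => Matrix.ext fun i j => congrFun h (i, j))

theorem exists_word_regevSum_eq_scalar (F κ : Type*) [Field F] [CharZero F] [Fintype κ]
    [DecidableEq κ] [Nonempty κ] :
    ∃ word : List (κ × κ ⊕ κ × κ), (word : Multiset (κ × κ ⊕ κ × κ)) = univ.val ∧
      ∀ b : κ × κ → Matrix κ κ F, LinearIndependent F b →
        ∃ c : F, c ≠ 0 ∧ regevSum word b b = Matrix.scalar κ c := by
  obtain ⟨w, hw, htrace⟩ := exists_doubleAltTrace_ne_zero κ
  obtain ⟨m, e, he⟩ := exists_equiv_finRotate hw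
  refine ⟨List.ofFn e, ?_, fun b hb => ?_⟩
  · rw [← Finset.map_univ_equiv e, Finset.map_val, Fin.univ_def, List.ofFn_eq_map]
    rfl
  have hdet := det_coordMatrix_ne_zero hb
  obtain ⟨c, hc⟩ := regevSum_matrixUnit_mem_range_scalar (R := F) e
  refine ⟨(coordMatrix b).det * (coordMatrix b).det * c, mul_ne_zero (mul_ne_zero hdet hdet) ?_, ?_⟩
  · rintro rfl
    exact regevSum_matrixUnit_ne_zero F he htrace (by rw [← hc, map_zero])
  · rw [regevSum_eq_smul, ← hc, ← smul_eq_mul, Matrix.scalar_apply, Matrix.scalar_apply,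
      ← Matrix.diagonal_smul]
    rfl

end RegevSum

section GradedStructure

variable {F G A : Type*} [Field F] [Group G] [DecidableEq G] [NonUnitalRing A] [Module F A]
  {𝒜 : G → Submodule F A}

lemma IsGrading.eq_top_of_le (h : IsGrading 𝒜) {S : Submodule F A} (hS : ∀ g, 𝒜 g ≤ S) :
    S = ⊤ :=
  top_unique (h.isInternal.submodule_iSup_eq_top.ge.trans (iSup_le hS))

variable [IsScalarTower F A A] [SMulCommClass F A A]

lemma IsGrading.isGradedIdeal_iSup (h : IsGrading 𝒜) {I : G → Submodule F A}
    (hle : ∀ g, I g ≤ 𝒜 g) (hl : ∀ g k, ∀ a ∈ 𝒜 g, ∀ x ∈ I k, a * x ∈ I (g * k))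
    (hr : ∀ g k, ∀ a ∈ 𝒜 g, ∀ x ∈ I k, x * a ∈ I (k * g)) : IsGradedIdeal 𝒜 (⨆ g, I g) where
  mul_mem_left a x hx := by
    have hmap : Submodule.map₂ (LinearMap.mul F A) ⊤ (⨆ g, I g) ≤ ⨆ g, I g := by
      simp only [← h.isInternal.submodule_iSup_eq_top, Submodule.map₂_iSup_left,
        Submodule.map₂_iSup_right]
      exact iSup₂_le fun k g => Submodule.map₂_le.2 fun a ha x hx =>
        Submodule.mem_iSup_of_mem _ (hl g k a ha x hx)
    exact Submodule.map₂_le.1 hmap a trivial x hx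
  mul_mem_right a x hx := by
    have hmap : Submodule.map₂ (LinearMap.mul F A) (⨆ g, I g) ⊤ ≤ ⨆ g, I g := by
      simp only [← h.isInternal.submodule_iSup_eq_top, Submodule.map₂_iSup_left,
        Submodule.map₂_iSup_right]
      exact iSup₂_le fun g k => Submodule.map₂_le.2 fun x hx a ha =>
        Submodule.mem_iSup_of_mem _ (hr g k a ha x hx)
    exact Submodule.map₂_le.1 hmap x hx a trivial
  homogeneous := le_antisymm (iSup_mono fun g => le_inf (le_iSup I g) (hle g))
    (iSup_le fun _ => inf_le_left)

theorem IsGradedSimple.eq_bot_or_eq (h : IsGrading 𝒜) (hs : IsGradedSimple 𝒜)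
    (I : G → Submodule F A) (hle : ∀ g, I g ≤ 𝒜 g)
    (hl : ∀ g k, ∀ a ∈ 𝒜 g, ∀ x ∈ I k, a * x ∈ I (g * k))
    (hr : ∀ g k, ∀ a ∈ 𝒜 g, ∀ x ∈ I k, x * a ∈ I (k * g)) :
    (∀ g, I g = ⊥) ∨ ∀ g, I g = 𝒜 g := by
  refine (hs.eq_bot_or_eq_top _ (h.isGradedIdeal_iSup hle hl hr)).imp
    (fun hbot => iSup_eq_bot.1 hbot) fun htop g => le_antisymm (hle g) ?_
  calc 𝒜 g = (I g ⊔ ⨆ (k) (_ : k ≠ g), I k) ⊓ 𝒜 g := by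
        rw [← iSup_split_single, htop, top_inf_eq]
    _ = I g ⊔ (⨆ (k) (_ : k ≠ g), I k) ⊓ 𝒜 g := sup_inf_assoc_of_le _ (hle g)
    _ ≤ I g ⊔ (⨆ (k) (_ : k ≠ g), 𝒜 k) ⊓ 𝒜 g := by gcongr; exact hle _
    _ = I g := by
        rw [(h.isInternal.submodule_iSupIndep g).symm.eq_bot, sup_bot_eq]

lemma IsGradedSimple.map₂_mul_eq_top (h : IsGrading 𝒜) (hs : IsGradedSimple 𝒜) :
    Submodule.map₂ (LinearMap.mul F A) ⊤ ⊤ = ⊤ := by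
  let S := Submodule.map₂ (LinearMap.mul F A) ⊤ ⊤
  have hmul (a b : A) : a * b ∈ S :=
    Submodule.apply_mem_map₂ _ Submodule.mem_top Submodule.mem_top
  rcases hs.eq_bot_or_eq h (fun g => S ⊓ 𝒜 g) (fun g => inf_le_right)
    (fun g k a ha x hx => ⟨hmul a x, h.mul_mem ha hx.2⟩)
    (fun g k a ha x hx => ⟨hmul x a, h.mul_mem hx.2 ha⟩) with hbot | htop
  · exfalso
    have hzero : S ≤ ⊥ := by
      simp only [S, ← h.isInternal.submodule_iSup_eq_top, Submodule.map₂_iSup_left,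
        Submodule.map₂_iSup_right]
      exact iSup₂_le fun k g => Submodule.map₂_le.2 fun a ha b hb =>
        hbot (g * k) ▸ ⟨hmul a b, h.mul_mem ha hb⟩
    obtain ⟨a, b, hab⟩ := hs.exists_mul_ne_zero
    exact hab (hzero (hmul a b))
  · exact h.eq_top_of_le fun g => (htop g).ge.trans inf_le_left

end GradedStructure

lemma eq_bot_of_le_mul_self_of_le_jacobson {U : Type*} [Ring U] [IsSemiprimaryRing U]
    {I : Ideal U} (hI : I ≤ I * I) (hJ : I ≤ Ring.jacobson U) : I = ⊥ := by
  have hpow (k : ℕ) : I ≤ Ring.jacobson U ^ (k + 1) := by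
    induction k with
    | zero => rwa [zero_add, Submodule.pow_one]
    | succ k ih => exact hI.trans (Ideal.mul_mono ih hJ)
  obtain ⟨N, hN⟩ := IsSemiprimaryRing.isNilpotent (R := U)
  exact le_bot_iff.1 ((hpow N).trans (by rw [Submodule.pow_succ, hN, zero_mul]; rfl))

lemma exists_algHom_matrix_apply_ne_zero (F : Type*) {U : Type*} [Field F] [IsAlgClosed F]
    [Ring U] [Algebra F U] [FiniteDimensional F U] {u : U} (hu : u ∉ Ring.jacobson U) :
    ∃ (n : ℕ) (_ : NeZero n) (π : U →ₐ[F] Matrix (Fin n) (Fin n) F),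
      Function.Surjective π ∧ π u ≠ 0 := by
  have : IsArtinianRing U := IsArtinianRing.of_finite F U
  obtain ⟨m, d, hd, ⟨e⟩⟩ :=
    IsSemisimpleRing.exists_algEquiv_pi_matrix_of_isAlgClosed F (U ⧸ Ring.jacobson U)
  have heu : e (Ideal.Quotient.mk _ u) ≠ 0 := by
    rwa [Ne, map_eq_zero_iff _ e.injective, Ideal.Quotient.eq_zero_iff_mem]
  obtain ⟨i, hi⟩ := Function.ne_iff.1 heu
  let π : U →ₐ[F] Matrix (Fin (d i)) (Fin (d i)) F :=
    (Pi.evalAlgHom F (fun i => Matrix (Fin (d i)) (Fin (d i)) F) i).comp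
      (e.toAlgHom.comp (Ideal.Quotient.mkₐ F _))
  exact ⟨d i, hd i, π,
    (Function.surjective_eval i).comp (e.surjective.comp Ideal.Quotient.mk_surjective), hi⟩

lemma surjective_of_range_mul_closed {F A B : Type*} [Field F] [NonUnitalRing A] [Module F A]
    [Ring B] [Algebra F B] [IsSimpleRing B] (p : A →ₙₐ[F] B)
    (hl : ∀ x a, x * p a ∈ Set.range p) (hr : ∀ x a, p a * x ∈ Set.range p) {a : A} (ha : p a ≠ 0) :
    Function.Surjective p := by
  let I : TwoSidedIdeal B := TwoSidedIdeal.mk' (Set.range p) ⟨0, map_zero p⟩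
    (by rintro _ _ ⟨a, rfl⟩ ⟨b, rfl⟩; exact ⟨a + b, map_add p a b⟩)
    (by rintro _ ⟨a, rfl⟩; exact ⟨-a, map_neg p a⟩)
    (by rintro x _ ⟨a, rfl⟩; exact hl x a) (by rintro _ x ⟨a, rfl⟩; exact hr x a)
  have hmem (x : B) : x ∈ I ↔ x ∈ Set.range p := TwoSidedIdeal.mem_mk' _ _ _ _ _ _ x
  have hone : 1 ∈ I := IsSimpleRing.one_mem_of_ne_zero_mem I ha ((hmem _).2 ⟨a, rfl⟩)
  exact fun x => (hmem x).1 (by simpa using I.mul_mem_left x 1 hone)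

section MatrixQuotient

variable {F A : Type*} [Field F] [NonUnitalRing A] [Module F A] [IsScalarTower F A A]
  [SMulCommClass F A A] [FiniteDimensional F A]

instance finiteDimensional_unitization : FiniteDimensional F (Unitization F A) :=
  Module.Finite.equiv (Unitization.linearEquiv F F A).symm

-- `A`, as an ideal of its unitization, is idempotent and nonzero, hence not nilpotent.
lemma exists_inr_notMem_jacobson [Nontrivial A]
    (hA : Submodule.map₂ (LinearMap.mul F A) ⊤ ⊤ = ⊤) :
    ∃ a : A, (a : Unitization F A) ∉ Ring.jacobson (Unitization F A) := by
  have : IsArtinianRing (Unitization F A) := IsArtinianRing.of_finite F _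
  let I : Ideal (Unitization F A) := RingHom.ker (Unitization.fstHom F A)
  have hinr (a : A) : (a : Unitization F A) ∈ I := Unitization.fst_inr F a
  have hsnd : ∀ u ∈ I, (u.snd : Unitization F A) = u := fun u hu =>
    Unitization.ext (Eq.symm hu) rfl
  have hsq : ⊤ ≤ ((I * I).restrictScalars F).comap (Unitization.inrHom F F A) := by
    rw [← hA, Submodule.map₂_le]
    intro a _ b _
    change ((a * b : A) : Unitization F A) ∈ I * I
    rw [Unitization.inr_mul]
    exact Ideal.mul_mem_mul (hinr a) (hinr b)
  by_contra! hJ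
  have hbot : I = ⊥ := eq_bot_of_le_mul_self_of_le_jacobson
    (fun u hu => hsnd u hu ▸ hsq (Submodule.mem_top (x := u.snd)))
    (fun u hu => hsnd u hu ▸ hJ u.snd)
  obtain ⟨a, ha⟩ := exists_ne (0 : A)
  exact ha (Unitization.inr_injective (R := F) (hbot ▸ hinr a : (a : Unitization F A) ∈ ⊥))

theorem exists_surjective_matrix [IsAlgClosed F] [Nontrivial A]
    (hA : Submodule.map₂ (LinearMap.mul F A) ⊤ ⊤ = ⊤) :
    ∃ (n : ℕ) (_ : NeZero n) (p : A →ₙₐ[F] Matrix (Fin n) (Fin n) F), Function.Surjective p := by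
  obtain ⟨a, ha⟩ := exists_inr_notMem_jacobson hA
  obtain ⟨n, hn, π, hπ, hπa⟩ := exists_algHom_matrix_apply_ne_zero F ha
  let p : A →ₙₐ[F] Matrix (Fin n) (Fin n) F :=
    (π : Unitization F A →ₙₐ[F] _).comp (Unitization.inrNonUnitalAlgHom F A)
  have hmul (u v : Unitization F A) (b : A) (h : (b : Unitization F A) = u * v) :
      p b = π u * π v := by rw [← map_mul, ← h]; rfl
  refine ⟨n, hn, p, surjective_of_range_mul_closed p ?_ ?_ hπa⟩
  · intro x b
    obtain ⟨u, rfl⟩ := hπ x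
    exact ⟨u.fst • b + u.snd * b, hmul u b _ (by ext <;> simp)⟩
  · intro x b
    obtain ⟨u, rfl⟩ := hπ x
    exact ⟨u.fst • b + b * u.snd, hmul b u _ (by ext <;> simp)⟩

end MatrixQuotient

section SimplePregrading

variable {F G B : Type*} [Field F] [CommGroup G] [Ring B] [Algebra F B] {ℬ : G → Submodule F B}

/-- A family of subspaces spanning `B`, multiplicative like the components of a grading and
without proper nonzero stable subfamilies, but possibly far from independent. The components of a
graded simple algebra form such a family in every quotient by an ungraded ideal. -/
structure IsSimplePregrading (ℬ : G → Submodule F B) : Prop where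
  iSup_eq_top : ⨆ g, ℬ g = ⊤
  mul_mem : ∀ ⦃g k : G⦄ ⦃a b : B⦄, a ∈ ℬ g → b ∈ ℬ k → a * b ∈ ℬ (g * k)
  eq_bot_or_eq : ∀ C : G → Submodule F B, (∀ g, C g ≤ ℬ g) →
    (∀ g k, ∀ a ∈ ℬ g, ∀ x ∈ C k, a * x ∈ C (g * k)) →
    (∀ g k, ∀ a ∈ ℬ g, ∀ x ∈ C k, x * a ∈ C (k * g)) → (∀ g, C g = ⊥) ∨ ∀ g, C g = ℬ g

lemma IsSimplePregrading.mem_center (h : IsSimplePregrading ℬ) {z : B}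
    (hz : ∀ g, ∀ y ∈ ℬ g, z * y = y * z) : z ∈ Subalgebra.center F B := by
  have htop : ⊤ ≤ LinearMap.eqLocus (LinearMap.mulLeft F z) (LinearMap.mulRight F z) :=
    h.iSup_eq_top.ge.trans (iSup_le hz)
  exact Subalgebra.mem_center_iff.2 fun y => (htop (Submodule.mem_top (x := y))).symm

/-- The degrees by which the family `ℬ` may be translated. -/
def periodSubgroup (ℬ : G → Submodule F B) : Subgroup G where
  carrier := {k | ∀ g, ℬ (g * k) = ℬ g}
  one_mem' g := by rw [mul_one]
  mul_mem' {a b} ha hb g := by rw [← mul_assoc, hb, ha]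
  inv_mem' {a} ha g := by rw [← ha (g * a⁻¹), inv_mul_cancel_right]

lemma component_mul_period {k : G} (hk : k ∈ periodSubgroup ℬ) (g : G) : ℬ (g * k) = ℬ g := hk g

lemma mem_periodSubgroup_of_le [Finite G] {k : G} (hk : ∀ g, ℬ g ≤ ℬ (g * k)) :
    k ∈ periodSubgroup ℬ := by
  intro g
  refine le_antisymm ?_ (hk g)
  have hpow (i : ℕ) : ℬ (g * k) ≤ ℬ (g * k * k ^ i) := by
    induction i with
    | zero => simp
    | succ i ih => exact ih.trans ((hk _).trans_eq (by rw [mul_assoc _ (k ^ i), ← pow_succ]))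
  have horder := hpow (orderOf k - 1)
  rwa [mul_assoc, mul_pow_sub_one (orderOf_pos k).ne', pow_orderOf_eq_one, mul_one] at horder

variable {ι : Type*} {δ : ι → G} {D : Finset ι}

/-- `v` expands `b` as a sum of elements of the translates by `δ i`, `i ∈ D`, of the component of
degree `g`. -/
def IsExpansion (ℬ : G → Submodule F B) (δ : ι → G) (D : Finset ι) (g : G) (b : B)
    (v : ι → B) : Prop :=
  (∀ i ∈ D, v i ∈ ℬ (g * δ i)) ∧ ∑ i ∈ D, v i = b

lemma exists_isExpansion_iff {g : G} {b : B} :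
    (∃ v, IsExpansion ℬ δ D g b v) ↔ b ∈ ⨆ i ∈ D, ℬ (g * δ i) := by
  refine ⟨?_, fun hb => ?_⟩
  · rintro ⟨v, hv, rfl⟩
    exact Submodule.sum_mem_biSup hv
  · obtain ⟨v, hv⟩ := (Submodule.mem_iSup_finset_iff_exists_sum _ b).1 hb
    exact ⟨fun i => v i, fun i _ => (v i).2, hv⟩

lemma IsExpansion.eq {g : G} {b : B} {v w : ι → B} (hD : D.SupIndep fun i => ℬ (g * δ i))
    (hv : IsExpansion ℬ δ D g b v) (hw : IsExpansion ℬ δ D g b w) {i : ι} (hi : i ∈ D) :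
    v i = w i := by
  classical
  have hsub (j : ι) (hj : j ∈ D) : v j - w j ∈ ℬ (g * δ j) := sub_mem (hv.1 j hj) (hw.1 j hj)
  have hsum : v i - w i + ∑ j ∈ D.erase i, (v j - w j) = 0 := by
    rw [add_sum_erase D (fun j => v j - w j) hi, sum_sub_distrib, hv.2, hw.2, sub_self]
  have hrest : v i - w i ∈ (D.erase i).sup fun j => ℬ (g * δ j) := by
    rw [eq_neg_of_add_eq_zero_left hsum, Finset.sup_eq_iSup]
    exact neg_mem (Submodule.sum_mem_biSup fun j hj => hsub j (mem_of_mem_erase hj))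
  exact sub_eq_zero.1 (Submodule.disjoint_def.1
    (hD (erase_subset i D) hi (notMem_erase i D)) _ (hsub i hi) hrest)

lemma IsExpansion.mul_left (h : IsSimplePregrading ℬ) {g k : G} {a b : B} {v : ι → B}
    (ha : a ∈ ℬ g) (hv : IsExpansion ℬ δ D k b v) :
    IsExpansion ℬ δ D (g * k) (a * b) fun i => a * v i :=
  ⟨fun i hi => mul_assoc g k (δ i) ▸ h.mul_mem ha (hv.1 i hi), by rw [← mul_sum, hv.2]⟩

lemma IsExpansion.mul_right (h : IsSimplePregrading ℬ) {g k : G} {a b : B} {v : ι → B}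
    (ha : a ∈ ℬ g) (hv : IsExpansion ℬ δ D k b v) :
    IsExpansion ℬ δ D (k * g) (b * a) fun i => v i * a :=
  ⟨fun i hi => mul_right_comm k g (δ i) ▸ h.mul_mem (hv.1 i hi) ha, by rw [← sum_mul, hv.2]⟩

-- The `i`-th coefficient of the unique expansion is a bimodule map, so it is the multiplication by
-- its value at the unit.
lemma exists_coeff_eq_mul (h : IsSimplePregrading ℬ)
    (hD : ∀ g, D.SupIndep fun i => ℬ (g * δ i)) (hle : ∀ g, ℬ g ≤ ⨆ i ∈ D, ℬ (g * δ i)) :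
    ∃ z : ι → B, ∀ g, ∀ y ∈ ℬ g, ∀ v, IsExpansion ℬ δ D g y v →
      ∀ i ∈ D, v i = z i * y ∧ v i = y * z i := by
  have hcomm {g k : G} {a b : B} {v w : ι → B} (ha : a ∈ ℬ g) (hb : b ∈ ℬ k)
      (hv : IsExpansion ℬ δ D g a v) (hw : IsExpansion ℬ δ D k b w) {i : ι} (hi : i ∈ D) :
      a * w i = v i * b :=
    (hw.mul_left h ha).eq (hD (g * k)) (hv.mul_right h hb) hi
  obtain ⟨f, hf, hone⟩ := (Submodule.mem_iSup_iff_exists_finsupp ℬ (1 : B)).1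
    (h.iSup_eq_top ▸ Submodule.mem_top)
  choose w hw using fun k => exists_isExpansion_iff.2 (hle k (hf k))
  refine ⟨fun i => ∑ k ∈ f.support, w k i, fun g y hy v hv i hi => ⟨?_, ?_⟩⟩
  · rw [← one_mul (v i), ← hone, Finsupp.sum, sum_mul, sum_mul]
    exact sum_congr rfl fun k _ => hcomm (hf k) hy (hw k) hv hi
  · rw [← mul_one (v i), ← hone, Finsupp.sum, mul_sum, mul_sum]
    exact sum_congr rfl fun k _ => (hcomm hy (hf k) hv (hw k) hi).symm

lemma exists_isExpansion_smul [Algebra.IsCentral F B] (h : IsSimplePregrading ℬ)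
    (hD : ∀ g, D.SupIndep fun i => ℬ (g * δ i)) (hle : ∀ g, ℬ g ≤ ⨆ i ∈ D, ℬ (g * δ i)) :
    ∃ c : ι → F, ∀ g, ∀ y ∈ ℬ g, IsExpansion ℬ δ D g y fun i => c i • y := by
  obtain ⟨z, hz⟩ := exists_coeff_eq_mul h hD hle
  have hex (g : G) (y : B) (hy : y ∈ ℬ g) : ∃ v, IsExpansion ℬ δ D g y v :=
    exists_isExpansion_iff.2 (hle g hy)
  have hscalar (i : ι) : ∃ c : F, i ∈ D → z i = algebraMap F B c := by
    by_cases hi : i ∈ D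
    · have hcenter : z i ∈ Subalgebra.center F B := h.mem_center fun g y hy => by
        obtain ⟨v, hv⟩ := hex g y hy
        rw [← (hz g y hy v hv i hi).1, (hz g y hy v hv i hi).2]
      obtain ⟨c, hc⟩ := Algebra.mem_bot.1 (Algebra.IsCentral.out hcenter)
      exact ⟨c, fun _ => hc.symm⟩
    · exact ⟨0, fun hmem => absurd hmem hi⟩
  choose c hc using hscalar
  refine ⟨c, fun g y hy => ?_⟩
  obtain ⟨v, hv⟩ := hex g y hy
  have hvc : ∀ i ∈ D, c i • y = v i := fun i hi => by
    rw [(hz g y hy v hv i hi).1, hc i hi, Algebra.smul_def]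
  exact ⟨fun i hi => by simpa only [hvc i hi] using hv.1 i hi, (sum_congr rfl hvc).trans hv.2⟩

lemma exists_mem_periodSubgroup [Finite G] [Nontrivial B] [Algebra.IsCentral F B]
    (h : IsSimplePregrading ℬ) (hD : ∀ g, D.SupIndep fun i => ℬ (g * δ i))
    (hle : ∀ g, ℬ g ≤ ⨆ i ∈ D, ℬ (g * δ i)) : ∃ i ∈ D, δ i ∈ periodSubgroup ℬ := by
  obtain ⟨c, hc⟩ := exists_isExpansion_smul h hD hle
  obtain ⟨i, hi, hci⟩ : ∃ i ∈ D, c i ≠ 0 := by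
    by_contra! hzero
    have hbot : ⨆ g, ℬ g ≤ ⊥ := iSup_le fun g y hy => by
      rw [Submodule.mem_bot, ← (hc g y hy).2]
      exact sum_eq_zero fun i hi => by rw [hzero i hi, zero_smul]
    exact bot_ne_top (le_bot_iff.1 hbot ▸ h.iSup_eq_top)
  exact ⟨i, hi, mem_periodSubgroup_of_le fun g y hy =>
    ((ℬ _).smul_mem_iff hci).1 ((hc g y hy).1 i hi)⟩

theorem IsSimplePregrading.supIndep [Finite G] [Nontrivial B] [Algebra.IsCentral F B]
    (h : IsSimplePregrading ℬ) (hδ : ∀ i j, (δ i)⁻¹ * δ j ∈ periodSubgroup ℬ → i = j)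
    (D : Finset ι) (g : G) : D.SupIndep fun i => ℬ (g * δ i) := by
  classical
  induction D using Finset.induction generalizing g with
  | empty => exact Finset.supIndep_empty _
  | insert j D hj ih =>
    refine (ih g).insert ?_
    let ε (i : ι) : G := (δ j)⁻¹ * δ i
    have hind (k : G) : D.SupIndep fun i => ℬ (k * ε i) := by
      simpa only [ε, mul_assoc] using ih (k * (δ j)⁻¹)
    rcases h.eq_bot_or_eq (fun k => ℬ k ⊓ ⨆ i ∈ D, ℬ (k * ε i)) (fun _ => inf_le_left)
      (fun k l a ha x hx => ⟨h.mul_mem ha hx.1, exists_isExpansion_iff.1 <|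
        (exists_isExpansion_iff.2 hx.2).imp' _ fun _ hv => hv.mul_left h ha⟩)
      (fun k l a ha x hx => ⟨h.mul_mem hx.1 ha, exists_isExpansion_iff.1 <|
        (exists_isExpansion_iff.2 hx.2).imp' _ fun _ hv => hv.mul_right h ha⟩) with hbot | hall
    · rw [disjoint_iff, Finset.sup_eq_iSup]
      simpa only [ε, mul_assoc, mul_inv_cancel_left] using hbot (g * δ j)
    · obtain ⟨i, hi, hper⟩ := exists_mem_periodSubgroup h hind fun k => inf_eq_left.1 (hall k)
      exact absurd (hδ j i hper ▸ hi) hj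

end SimplePregrading

section Quotient

variable {F G A B : Type*} [Field F] [CommGroup G] [DecidableEq G] [NonUnitalRing A]
  [Module F A] [Ring B] [Algebra F B] {𝒜 : G → Submodule F A} {p : A →ₙₐ[F] B}

/-- The image under `p` of the component of degree `g`. -/
def mapComponent (𝒜 : G → Submodule F A) (p : A →ₙₐ[F] B) (g : G) : Submodule F B :=
  (𝒜 g).map (p : A →ₗ[F] B)

/-- The elements whose image under `p` is a central unit. -/
def centralUnitPreimage (p : A →ₙₐ[F] B) : Subsemigroup A :=
  (Subsemigroup.center B ⊓ (IsUnit.submonoid B).toSubsemigroup).comap p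

lemma mem_centralUnitPreimage {a : A} :
    a ∈ centralUnitPreimage p ↔ p a ∈ Set.center B ∧ IsUnit (p a) := Iff.rfl

variable [IsScalarTower F A A] [SMulCommClass F A A]

lemma isSimplePregrading_mapComponent (h : IsGrading 𝒜) (hs : IsGradedSimple 𝒜)
    (hp : Function.Surjective p) : IsSimplePregrading (mapComponent 𝒜 p) where
  iSup_eq_top := by
    simp only [mapComponent, ← Submodule.map_iSup, h.isInternal.submodule_iSup_eq_top,
      Submodule.map_top]
    exact LinearMap.range_eq_top.2 hp
  mul_mem := by
    rintro g k _ _ ⟨a, ha, rfl⟩ ⟨b, hb, rfl⟩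
    exact ⟨a * b, h.mul_mem ha hb, map_mul p a b⟩
  eq_bot_or_eq C hle hl hr := by
    rcases hs.eq_bot_or_eq h (fun g => 𝒜 g ⊓ (C g).comap (p : A →ₗ[F] B))
      (fun g => inf_le_left)
      (fun g k a ha x hx => ⟨h.mul_mem ha hx.1, show p (a * x) ∈ _ from
        map_mul p a x ▸ hl g k (p a) ⟨a, ha, rfl⟩ (p x) hx.2⟩)
      (fun g k a ha x hx => ⟨h.mul_mem hx.1 ha, show p (x * a) ∈ _ from
        map_mul p x a ▸ hr g k (p a) ⟨a, ha, rfl⟩ (p x) hx.2⟩) with hbot | hall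
    · refine Or.inl fun g => eq_bot_iff.2 fun y hy => ?_
      obtain ⟨a, ha, rfl⟩ := hle g hy
      have hzero : a ∈ (⊥ : Submodule F A) := hbot g ▸ ⟨ha, hy⟩
      exact (congrArg p hzero).trans (map_zero p)
    · exact Or.inr fun g =>
        le_antisymm (hle g) (Submodule.map_le_iff_le_comap.2 (inf_eq_left.1 (hall g)))

lemma eq_zero_of_map_eq_zero [Nontrivial B] (h : IsGrading 𝒜) (hs : IsGradedSimple 𝒜)
    (hp : Function.Surjective p) {g : G} {a : A} (ha : a ∈ 𝒜 g) (hpa : p a = 0) : a = 0 := by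
  rcases hs.eq_bot_or_eq h (fun g => 𝒜 g ⊓ LinearMap.ker (p : A →ₗ[F] B))
    (fun g => inf_le_left)
    (fun g k a ha x hx => ⟨h.mul_mem ha hx.1, show p (a * x) = 0 by
      rw [map_mul, show p x = 0 from hx.2, mul_zero]⟩)
    (fun g k a ha x hx => ⟨h.mul_mem hx.1 ha, show p (x * a) = 0 by
      rw [map_mul, show p x = 0 from hx.2, zero_mul]⟩) with hbot | hall
  · exact (Submodule.mem_bot F).1 (hbot g ▸ ⟨ha, hpa⟩)
  · have hker := h.eq_top_of_le fun g => inf_eq_left.1 (hall g)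
    obtain ⟨e, he⟩ := hp 1
    have hzero : p e = 0 := LinearMap.mem_ker.1 (hker ▸ Submodule.mem_top)
    exact absurd (hzero.symm.trans he) zero_ne_one

lemma finrank_mapComponent [Nontrivial B] (h : IsGrading 𝒜) (hs : IsGradedSimple 𝒜)
    (hp : Function.Surjective p) (g : G) :
    Module.finrank F (mapComponent 𝒜 p g) = gDim 𝒜 g :=
  (LinearEquiv.ofBijective ((p : A →ₗ[F] B).submoduleMap (𝒜 g))
    ⟨(injective_iff_map_eq_zero _).2 fun x hx =>
      Subtype.ext (eq_zero_of_map_eq_zero h hs hp x.2 (congrArg Subtype.val hx)),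
      (p : A →ₗ[F] B).submoduleMap_surjective (𝒜 g)⟩).finrank_eq.symm

variable [Nontrivial B]

lemma mul_comm_of_mem_centralUnitPreimage (h : IsGrading 𝒜) (hs : IsGradedSimple 𝒜)
    (hp : Function.Surjective p) {g : G} {v : A} (hv : v ∈ 𝒜 g)
    (hpv : v ∈ centralUnitPreimage p) (a : A) : a * v = v * a := by
  have htop : LinearMap.eqLocus (LinearMap.mulRight F v) (LinearMap.mulLeft F v) = ⊤ := by
    refine h.eq_top_of_le fun k a ha => sub_eq_zero.1 (eq_zero_of_map_eq_zero h hs hp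
      (sub_mem (h.mul_mem ha hv) (mul_comm g k ▸ h.mul_mem hv ha)) ?_)
    rw [map_sub, LinearMap.mulRight_apply, LinearMap.mulLeft_apply, map_mul, map_mul,
      Semigroup.mem_center_iff.1 (mem_centralUnitPreimage.1 hpv).1, sub_self]
  exact (htop ▸ Submodule.mem_top : a ∈ LinearMap.eqLocus _ _)

lemma mul_left_surjective_of_mem_centralUnitPreimage (h : IsGrading 𝒜) (hs : IsGradedSimple 𝒜)
    (hp : Function.Surjective p) {g : G} {v : A} (hv : v ∈ 𝒜 g)
    (hpv : v ∈ centralUnitPreimage p) : Function.Surjective (v * ·) := by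
  have hcomm := mul_comm_of_mem_centralUnitPreimage h hs hp hv hpv
  rcases hs.eq_bot_or_eq h (fun k => 𝒜 k ⊓ LinearMap.range (LinearMap.mulLeft F v))
    (fun k => inf_le_left)
    (fun k l a ha x hx => ⟨h.mul_mem ha hx.1, by
      obtain ⟨y, rfl⟩ := hx.2
      exact ⟨a * y, by simp only [LinearMap.mulLeft_apply, ← mul_assoc, hcomm]⟩⟩)
    (fun k l a ha x hx => ⟨h.mul_mem hx.1 ha, by
      obtain ⟨y, rfl⟩ := hx.2
      exact ⟨y * a, (mul_assoc v y a).symm⟩⟩) with hbot | hall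
  · obtain ⟨e, he⟩ := hp 1
    have hker : LinearMap.ker (LinearMap.mulLeft F v) = ⊤ := h.eq_top_of_le fun k a ha =>
      (Submodule.mem_bot F).1 (hbot (g * k) ▸ ⟨h.mul_mem hv ha, a, rfl⟩)
    have hve : v * e = 0 := (LinearMap.mem_ker (f := LinearMap.mulLeft F v)).1
      (hker ▸ Submodule.mem_top)
    have hpv0 : p v = 0 := by rw [← mul_one (p v), ← he, ← map_mul, hve, map_zero]
    exact absurd hpv0 (mem_centralUnitPreimage.1 hpv).2.ne_zero
  · exact LinearMap.range_eq_top.1 (h.eq_top_of_le fun k => inf_eq_left.1 (hall k))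

theorem mem_center_and_isInvertible (h : IsGrading 𝒜) (hs : IsGradedSimple 𝒜)
    (hp : Function.Surjective p) {g : G} {v : A} (hv : v ∈ 𝒜 g)
    (hpv : v ∈ centralUnitPreimage p) : v ∈ Set.center A ∧ IsInvertible v := by
  have hcomm := mul_comm_of_mem_centralUnitPreimage h hs hp hv hpv
  have hsurj := mul_left_surjective_of_mem_centralUnitPreimage h hs hp hv hpv
  refine ⟨Semigroup.mem_center_iff.2 hcomm, ?_⟩
  obtain ⟨e, he : v * e = v⟩ := hsurj v
  have hunit (a : A) : e * a = a ∧ a * e = a := by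
    obtain ⟨b, rfl : v * b = a⟩ := hsurj a
    exact ⟨by rw [← mul_assoc, hcomm e, he], by rw [← hcomm b, mul_assoc, he]⟩
  obtain ⟨w, hw : v * w = e⟩ := hsurj e
  exact ⟨e, hunit, w, hw, (hcomm w).trans hw⟩

end Quotient

section Monomials

/-- The list of letters of a word. -/
def letters {α : Type*} (w : FreeSemigroup α) : List α := w.head :: w.tail

lemma letters_injective {α : Type*} : Function.Injective (letters (α := α)) :=
  fun _ _ hvw => FreeSemigroup.ext (List.cons.inj hvw).1 (List.cons.inj hvw).2

lemma letters_mul {α : Type*} (v w : FreeSemigroup α) :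
    letters (v * w) = letters v ++ letters w := rfl

lemma letters_map {α β : Type*} (f : α → β) (w : FreeSemigroup α) :
    letters (FreeSemigroup.map f w) = (letters w).map f := by
  induction w using FreeSemigroup.recOnMul with
  | ih1 x => rfl
  | ih2 x y hx hy => rw [map_mul, letters_mul, hx, hy, letters_mul, List.map_append]

lemma map_lift_eq_prod {α S M : Type*} [Semigroup S] [Monoid M] (q : S →ₙ* M) (f : α → S)
    (w : FreeSemigroup α) : q (FreeSemigroup.lift f w) = ((letters w).map (q ∘ f)).prod := by
  induction w using FreeSemigroup.recOnMul with
  | ih1 x => exact (List.prod_singleton).symm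
  | ih2 x y hx hy => rw [map_mul, map_mul, hx, hy, letters_mul, List.map_append, List.prod_append]

variable {F G : Type*} [Field F]

/-- The word `w` in the variables as a polynomial. -/
noncomputable def monomial (F : Type*) {G : Type*} [Field F] (w : FreeSemigroup (Var G)) :
    GradedPoly F G :=
  MonoidAlgebra.single w 1

lemma eval_monomial {A : Type*} [NonUnitalRing A] [Module F A] [IsScalarTower F A A]
    [SMulCommClass F A A] (ρ : Var G → A) (w : FreeSemigroup (Var G)) :
    eval ρ (monomial F w) = FreeSemigroup.lift ρ w := by
  simp [eval, monomial]

lemma monomial_mul (v w : FreeSemigroup (Var G)) :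
    monomial F (v * w) = monomial F v * monomial F w := by
  simp [monomial, MonoidAlgebra.single_mul_single]

lemma rename_monomial (σ : Perm (Var G)) (w : FreeSemigroup (Var G)) :
    rename σ (monomial F w) = monomial F (FreeSemigroup.map σ w) := by
  rw [rename, eval_monomial]
  induction w using FreeSemigroup.recOnMul with
  | ih1 x => rfl
  | ih2 x y hx hy => rw [map_mul, map_mul, monomial_mul, hx, hy]

lemma isMultilinear_monomial {V : Finset (Var G)} {w : FreeSemigroup (Var G)}
    (hw : (letters w : Multiset (Var G)) = V.val) : IsMultilinear V (monomial F w) :=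
  Submodule.subset_span ⟨w, hw, rfl⟩

lemma IsMultilinear.mul [DecidableEq G] {V W : Finset (Var G)} {f g : GradedPoly F G}
    (hf : IsMultilinear V f) (hg : IsMultilinear W g) (hVW : Disjoint V W) :
    IsMultilinear (V ∪ W) (f * g) := by
  have hfg := Submodule.apply_mem_map₂ (LinearMap.mul F (GradedPoly F G)) hf hg
  rw [Submodule.map₂_span_span] at hfg
  refine Submodule.span_le.2 ?_ hfg
  rintro _ ⟨_, ⟨v, hv, rfl⟩, _, ⟨w, hw, rfl⟩, rfl⟩
  have hvw : (letters (v * w) : Multiset (Var G)) = (V ∪ W).val := by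
    rw [letters_mul, ← Multiset.coe_add, ← Finset.disjUnion_eq_union V W hVW]
    exact congrArg₂ (· + ·) hv hw
  have hmem := isMultilinear_monomial (F := F) hvw
  rwa [monomial_mul] at hmem

lemma IsMultilinear.rename_eq_self {W : Finset (Var G)} {g : GradedPoly F G}
    (hg : IsMultilinear W g) {σ : Perm (Var G)} (hσ : ∀ x ∈ W, σ x = x) : rename σ g = g := by
  let L : GradedPoly F G →ₗ[F] GradedPoly F G :=
    (rename σ : GradedPoly F G →ₙₐ[F] GradedPoly F G)
  refine LinearMap.eqOn_span (f := L) (g := LinearMap.id) ?_ hg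
  rintro _ ⟨w, hw, rfl⟩
  refine (rename_monomial σ w).trans (congrArg (monomial F) (letters_injective ?_))
  rw [letters_map]
  exact (List.map_congr_left fun x hx => hσ x (hw ▸ hx : x ∈ W.val)).trans (List.map_id _)

lemma eval_mem_of_isMultilinear {A : Type*} [NonUnitalRing A] [Module F A] [IsScalarTower F A A]
    [SMulCommClass F A A] [CommGroup G] [DecidableEq G] {𝒜 : G → Submodule F A}
    (h : IsGrading 𝒜) {ρ : Var G → A} (hρ : IsGradedSubst 𝒜 ρ) {V : Finset (Var G)}
    {f : GradedPoly F G} (hf : IsMultilinear V f) : eval ρ f ∈ 𝒜 (∏ x ∈ V, x.1) := by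
  let L : GradedPoly F G →ₗ[F] A := (eval ρ : GradedPoly F G →ₙₐ[F] A)
  refine Submodule.span_le (p := (𝒜 _).comap L).2 ?_ hf
  rintro _ ⟨w, hw, rfl⟩
  have hprod : ∏ x ∈ V, x.1 = ((letters w).map Prod.fst).prod := by
    rw [Finset.prod, ← hw, Multiset.map_coe, Multiset.prod_coe, letters]
  rw [hprod]
  change eval ρ (monomial F w) ∈ 𝒜 _
  rw [eval_monomial]
  clear hw hprod
  induction w using FreeSemigroup.recOnMul with
  | ih1 x => simpa [letters] using hρ x
  | ih2 x y hx hy =>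
    rw [map_mul, letters_mul, List.map_append, List.prod_append]
    exact h.mul_mem hx hy

end Monomials

section RegevPolynomial

variable {F G ι : Type*} [Field F] [Fintype ι] [DecidableEq ι]

lemma sum_sign_smul_mul_left {M : Type*} [AddCommGroup M] (π : Perm ι) (f : Perm ι → M) :
    ∑ σ, (Perm.sign σ : ℤ) • f (π * σ) = (Perm.sign π : ℤ) • ∑ σ, (Perm.sign σ : ℤ) • f σ := by
  rw [← Equiv.sum_comp (Equiv.mulLeft π) fun σ => (Perm.sign σ : ℤ) • f σ, smul_sum]
  refine sum_congr rfl fun σ _ => ?_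
  rw [Equiv.coe_mulLeft, Perm.sign_mul, smul_smul, Units.val_mul, ← mul_assoc,
    Int.units_coe_mul_self, one_mul]

/-- Regev's polynomial: the sum over all permutations of the variables of both kinds, with signs,
of a word in two sets of variables. -/
noncomputable def regevPoly (F : Type*) [Field F] (word : FreeSemigroup (ι ⊕ ι))
    (x y : ι → Var G) : GradedPoly F G :=
  ∑ σ : Perm ι, (Perm.sign σ : ℤ) • ∑ τ : Perm ι, (Perm.sign τ : ℤ) •
    monomial F (FreeSemigroup.map (Sum.elim (x ∘ σ) (y ∘ τ)) word)

variable {word : FreeSemigroup (ι ⊕ ι)}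

lemma isMultilinear_regevPoly [DecidableEq G]
    (hword : (letters word : Multiset (ι ⊕ ι)) = univ.val) {x y : ι → Var G}
    (hinj : Function.Injective (Sum.elim x y)) :
    IsMultilinear (univ.image (Sum.elim x y)) (regevPoly F word x y) := by
  refine Submodule.sum_mem _ fun σ _ => zsmul_mem (Submodule.sum_mem _ fun τ _ =>
    zsmul_mem (isMultilinear_monomial ?_) _) _
  have hcomp : Sum.elim (x ∘ σ) (y ∘ τ) = Sum.elim x y ∘ Equiv.sumCongr σ τ :=
    Sum.elim_comp_map.symm
  rw [letters_map, ← Multiset.map_coe, hword, hcomp, ← Multiset.map_map, ← Equiv.coe_toEmbedding,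
    ← Finset.map_val, Finset.map_univ_equiv, Finset.image_val_of_injOn hinj.injOn]

lemma map_eval_regevPoly {A C : Type*} [NonUnitalRing A] [Module F A] [IsScalarTower F A A]
    [SMulCommClass F A A] [Ring C] [Algebra F C] (q : A →ₙₐ[F] C) (ρ : Var G → A)
    (x y : ι → Var G) :
    q (eval ρ (regevPoly F word x y)) = regevSum (letters word) (q ∘ ρ ∘ x) (q ∘ ρ ∘ y) := by
  simp only [regevPoly, map_sum, map_zsmul, regevSum, smul_sum, smul_smul]
  refine sum_congr rfl fun σ _ => sum_congr rfl fun τ _ => ?_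
  have hprod := map_lift_eq_prod (q : A →ₙ* C) ρ
    (FreeSemigroup.map (Sum.elim (x ∘ σ) (y ∘ τ)) word)
  rw [letters_map, List.map_map, Sum.comp_elim] at hprod
  rw [eval_monomial]
  exact congrArg _ hprod

lemma rename_regevPoly (π : Perm (Var G)) (x y : ι → Var G) :
    rename π (regevPoly F word x y) = regevPoly F word (π ∘ x) (π ∘ y) := by
  simp only [regevPoly, map_sum, map_zsmul, rename_monomial]
  refine sum_congr rfl fun σ _ => congrArg _ (sum_congr rfl fun τ _ => congrArg _ (congrArg _ ?_))
  refine letters_injective ?_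
  simp only [letters_map, List.map_map, Sum.comp_elim, Function.comp_assoc]

lemma regevPoly_comp_left (π : Perm ι) (x y : ι → Var G) :
    regevPoly F word (x ∘ π) y = (Perm.sign π : ℤ) • regevPoly F word x y :=
  sum_sign_smul_mul_left π fun σ => ∑ τ : Perm ι, (Perm.sign τ : ℤ) •
    monomial F (FreeSemigroup.map (Sum.elim (x ∘ σ) (y ∘ τ)) word)

lemma regevPoly_comp_right (π : Perm ι) (x y : ι → Var G) :
    regevPoly F word x (y ∘ π) = (Perm.sign π : ℤ) • regevPoly F word x y := by
  rw [regevPoly, regevPoly, smul_sum]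
  refine sum_congr rfl fun σ _ => Eq.trans (congrArg _ ?_) (smul_comm _ _ _)
  exact sum_sign_smul_mul_left π fun τ =>
    monomial F (FreeSemigroup.map (Sum.elim (x ∘ σ) (y ∘ τ)) word)

lemma exists_perm_ofSubtype_comp_eq {α : Type*} [DecidableEq α] {v : ι → α}
    (hv : Function.Injective v) {S : Finset α} (hS : ∀ a ∈ S, ∃ i, v i = a) (σ : Perm S) :
    ∃ π : Perm ι, Perm.ofSubtype σ ∘ v = v ∘ π ∧ Perm.sign π = Perm.sign σ := by
  choose u hu using fun a : S => hS a.1 a.2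
  let e : S ↪ ι := ⟨u, fun a b hab => Subtype.ext (by rw [← hu a, ← hu b, hab])⟩
  refine ⟨σ.viaFintypeEmbedding e, funext fun i => ?_, Perm.viaFintypeEmbedding_sign ..⟩
  by_cases hi : v i ∈ S
  · have hei : e ⟨v i, hi⟩ = i := hv (hu ⟨v i, hi⟩)
    have himage := Perm.viaFintypeEmbedding_apply_image σ e ⟨v i, hi⟩
    rw [hei] at himage
    rw [Function.comp_apply, Function.comp_apply, himage, Perm.ofSubtype_apply_of_mem σ hi]
    exact (hu _).symm
  · have hrange : i ∉ Set.range e := by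
      rintro ⟨a, rfl⟩
      exact hi ((hu a).symm ▸ a.2)
    rw [Function.comp_apply, Function.comp_apply,
      Perm.viaFintypeEmbedding_apply_notMem_range σ e hrange,
      Perm.ofSubtype_apply_of_not_mem σ hi]

lemma ofSubtype_comp_eq_self {α β : Type*} [DecidableEq α] {v : β → α} {S : Finset α}
    (hS : ∀ i, v i ∉ S) (σ : Perm S) : Perm.ofSubtype σ ∘ v = v :=
  funext fun i => Perm.ofSubtype_apply_of_not_mem σ (hS i)

variable [DecidableEq G] {x y : ι → Var G} {S : Finset (Var G)}

lemma isAlternating_regevPoly_left (hx : Function.Injective x) (hS : ∀ a ∈ S, ∃ i, x i = a)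
    (hy : ∀ i, y i ∉ S) : IsAlternating S (regevPoly F word x y) := by
  intro σ
  obtain ⟨π, hπ, hsign⟩ := exists_perm_ofSubtype_comp_eq hx hS σ
  rw [rename_regevPoly, ofSubtype_comp_eq_self hy, hπ, regevPoly_comp_left, hsign]

lemma isAlternating_regevPoly_right (hy : Function.Injective y) (hS : ∀ a ∈ S, ∃ i, y i = a)
    (hx : ∀ i, x i ∉ S) : IsAlternating S (regevPoly F word x y) := by
  intro σ
  obtain ⟨π, hπ, hsign⟩ := exists_perm_ofSubtype_comp_eq hy hS σ
  rw [rename_regevPoly, ofSubtype_comp_eq_self hx, hπ, regevPoly_comp_right, hsign]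

end RegevPolynomial

section Products

variable {F G : Type*} [Field F] [DecidableEq G]

lemma IsMultilinear.rename_ofSubtype_eq_self {W S : Finset (Var G)} {g : GradedPoly F G}
    (hg : IsMultilinear W g) (hSW : Disjoint S W) (σ : Perm S) :
    rename (Perm.ofSubtype σ) g = g :=
  hg.rename_eq_self fun _ hx => Perm.ofSubtype_apply_of_not_mem σ (disjoint_right.1 hSW hx)

lemma IsAlternating.mul_right {S W : Finset (Var G)} {f g : GradedPoly F G}
    (hf : IsAlternating S f) (hg : IsMultilinear W g) (hSW : Disjoint S W) :
    IsAlternating S (f * g) := fun σ => by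
  rw [map_mul, hf σ, hg.rename_ofSubtype_eq_self hSW, smul_mul_assoc]

lemma IsAlternating.mul_left {S W : Finset (Var G)} {f g : GradedPoly F G}
    (hf : IsAlternating S f) (hg : IsMultilinear W g) (hSW : Disjoint S W) :
    IsAlternating S (g * f) := fun σ => by
  rw [map_mul, hf σ, hg.rename_ofSubtype_eq_self hSW, mul_smul_comm]

lemma exists_isMultilinear_biUnion {ι : Type*} {V : ι → Finset (Var G)}
    (hV : ∀ i j, i ≠ j → Disjoint (V i) (V j)) {f : ι → GradedPoly F G}
    (hf : ∀ i, IsMultilinear (V i) (f i)) {M : Subsemigroup (GradedPoly F G)}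
    (hM : ∀ i, f i ∈ M) {s : Finset ι} (hs : s.Nonempty) :
    ∃ φ ∈ M, IsMultilinear (s.biUnion V) φ ∧
      ∀ i ∈ s, ∀ S ⊆ V i, IsAlternating S (f i) → IsAlternating S φ := by
  classical
  induction hs using Finset.Nonempty.cons_induction with
  | singleton i =>
    refine ⟨f i, hM i, (singleton_biUnion (t := V)).symm ▸ hf i, fun j hj S _ hS => ?_⟩
    rwa [mem_singleton.1 hj] at hS
  | cons i s hi _ ih =>
    obtain ⟨φ, hφM, hφ, halt⟩ := ih
    have hne {j : ι} (hj : j ∈ s) : i ≠ j := fun hij => hi (hij ▸ hj)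
    have hdisj : Disjoint (V i) (s.biUnion V) :=
      (disjoint_biUnion_right ..).2 fun j hj => hV i j (hne hj)
    refine ⟨f i * φ, mul_mem (hM i) hφM, ?_, fun j hj S hS hSalt => ?_⟩
    · rw [cons_eq_insert, biUnion_insert]
      exact (hf i).mul hφ hdisj
    · rcases mem_cons.1 hj with rfl | hj
      · exact hSalt.mul_right hφ (hdisj.mono_left hS)
      · exact (halt j hj S hS hSalt).mul_left (hf i) ((hV i j (hne hj)).symm.mono_left hS)

end Products

section VariableSets

variable {F G : Type*} [Field F] {m : G → ℕ}

/-- The variable of degree `s.1` with index `s.2` in the `j`-th family of variables. -/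
def labelVar (j : ℕ) (s : Σ g, Fin (m g)) : Var G := (s.1, Nat.pair j s.2)

lemma labelVar_inj {i j : ℕ} {r s : Σ g, Fin (m g)} :
    labelVar i r = labelVar j s ↔ i = j ∧ r = s := by
  refine ⟨fun hrs => ?_, by rintro ⟨rfl, rfl⟩; rfl⟩
  obtain ⟨g, a⟩ := r
  obtain ⟨k, b⟩ := s
  obtain ⟨rfl : g = k, hpair⟩ := Prod.mk.inj hrs
  obtain ⟨hij, hab⟩ := Nat.pair_eq_pair.1 hpair
  exact ⟨hij, congrArg (Sigma.mk g) (Fin.ext hab)⟩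

variable {κ K : Type*} {E : κ × K ≃ Σ g, Fin (m g)}

/-- The variables of the `j`-th family whose labels correspond to `κ × {k}` under `E`. -/
def slice (E : κ × K ≃ Σ g, Fin (m g)) (j : ℕ) (k : K) (a : κ) : Var G := labelVar j (E (a, k))

lemma slice_inj {i j : ℕ} {k l : K} {a b : κ} :
    slice E i k a = slice E j l b ↔ i = j ∧ k = l ∧ a = b := by
  rw [slice, slice, labelVar_inj, E.apply_eq_iff_eq, Prod.mk.injEq, and_comm (a := a = b)]

lemma sumElim_slice_inj {T : Type*} {N : ℕ} (e : T ⊕ T ≃ Fin N) {i j : T × K} {z z' : κ ⊕ κ} :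
    Sum.elim (slice E (e (Sum.inl i.1)) i.2) (slice E (e (Sum.inr i.1)) i.2) z =
        Sum.elim (slice E (e (Sum.inl j.1)) j.2) (slice E (e (Sum.inr j.1)) j.2) z' →
      i = j ∧ z = z' := by
  obtain ⟨i, k⟩ := i
  obtain ⟨j, l⟩ := j
  rcases z with a | a <;> rcases z' with b | b <;>
    simp_all [slice_inj, Fin.val_inj]

variable [DecidableEq G]

/-- The variables of degree `g` in the `j`-th family, `m g` in number. -/
def varSet (m : G → ℕ) (j : ℕ) (g : G) : Finset (Var G) :=
  univ.image fun a : Fin (m g) => labelVar j ⟨g, a⟩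

lemma mem_varSet {j : ℕ} {g : G} {x : Var G} :
    x ∈ varSet m j g ↔ ∃ s : Σ g, Fin (m g), s.1 = g ∧ labelVar j s = x := by
  simp only [varSet, mem_image, mem_univ, true_and]
  constructor
  · rintro ⟨a, rfl⟩
    exact ⟨⟨g, a⟩, rfl, rfl⟩
  · rintro ⟨⟨_, a⟩, rfl, rfl⟩
    exact ⟨a, rfl⟩

lemma isFoldAlternating_varSet [Fintype G] {N : ℕ} {φ : GradedPoly F G}
    (hmul : IsMultilinear ((univ : Finset (Fin N × G)).biUnion fun q => varSet m q.1 q.2) φ)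
    (halt : ∀ (j : Fin N) g, IsAlternating (varSet m j g) φ) :
    IsFoldAlternating N m (fun j => varSet m j) ∅ φ where
  degree j g x hx := by
    obtain ⟨s, hs, rfl⟩ := mem_varSet.1 hx
    exact hs
  card j g := by
    rw [varSet, card_image_of_injective, card_univ, Fintype.card_fin]
    exact fun a b hab => eq_of_heq (Sigma.mk.inj (labelVar_inj.1 hab).2).2
  disjoint i j g hij := by
    refine Finset.disjoint_left.2 fun x hx hx' => hij ?_
    obtain ⟨r, -, rfl⟩ := mem_varSet.1 hx
    obtain ⟨s, -, hsr⟩ := mem_varSet.1 hx'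
    exact Fin.ext (labelVar_inj.1 hsr).1.symm
  disjoint_rest j g := disjoint_empty_right _
  multilinear := by rwa [union_empty]
  alternating := halt

lemma slice_mem_varSet (j : ℕ) (k : K) (a : κ) :
    slice E j k a ∈ varSet m j (E (a, k)).1 :=
  mem_varSet.2 ⟨_, rfl, rfl⟩

lemma slice_notMem_varSet {i j : ℕ} (hij : i ≠ j) (k : K) (a : κ) (g : G) :
    slice E i k a ∉ varSet m j g := fun hmem => by
  obtain ⟨s, -, hs⟩ := mem_varSet.1 hmem
  exact hij (labelVar_inj.1 hs).1.symm

lemma exists_slice_of_mem_varSet [Nonempty K]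
    (hE : ∀ a b k l, (E (a, k)).1 = (E (b, l)).1 → k = l) (g : G) :
    ∃ k, ∀ j, ∀ x ∈ varSet m j g, ∃ a, slice E j k a = x := by
  by_cases hg : ∃ z, (E z).1 = g
  · obtain ⟨⟨b, k⟩, rfl⟩ := hg
    refine ⟨k, fun j x hx => ?_⟩
    obtain ⟨s, hs, rfl⟩ := mem_varSet.1 hx
    obtain ⟨⟨a, l⟩, rfl⟩ := E.surjective s
    obtain rfl := hE a b l k hs
    exact ⟨a, rfl⟩
  · refine ⟨Classical.arbitrary K, fun j x hx => ?_⟩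
    obtain ⟨s, rfl, -⟩ := mem_varSet.1 hx
    exact absurd ⟨E.symm s, by rw [E.apply_symm_apply]⟩ hg

lemma biUnion_varSet_eq_biUnion_slice {T : Type*} [Fintype G] [Fintype T] [Fintype κ] [Fintype K]
    {N : ℕ} (e : T ⊕ T ≃ Fin N) :
    (univ : Finset (Fin N × G)).biUnion (fun q => varSet m q.1 q.2) =
      (univ : Finset (T × K)).biUnion fun i =>
        univ.image (Sum.elim (slice E (e (Sum.inl i.1)) i.2) (slice E (e (Sum.inr i.1)) i.2)) := by
  ext x
  simp only [mem_biUnion, mem_univ, true_and, mem_image, Prod.exists]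
  constructor
  · rintro ⟨j, g, hx⟩
    obtain ⟨s, rfl, rfl⟩ := mem_varSet.1 hx
    obtain ⟨⟨a, k⟩, rfl⟩ := E.surjective s
    obtain ⟨i | i, rfl⟩ := e.surjective j
    · exact ⟨i, k, Sum.inl a, rfl⟩
    · exact ⟨i, k, Sum.inr a, rfl⟩
  · rintro ⟨i, k, a | a, rfl⟩
    · exact ⟨_, _, slice_mem_varSet _ k a⟩
    · exact ⟨_, _, slice_mem_varSet _ k a⟩

theorem exists_isFoldAlternating {T : Type*} [Fintype G] [Finite T] [Fintype κ] [Finite K]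
    [DecidableEq κ] [Nonempty T] [Nonempty K] {N : ℕ} (e : T ⊕ T ≃ Fin N)
    (hE : ∀ a b k l, (E (a, k)).1 = (E (b, l)).1 → k = l) {word : FreeSemigroup (κ ⊕ κ)}
    (hword : (letters word : Multiset (κ ⊕ κ)) = univ.val) {M : Subsemigroup (GradedPoly F G)}
    (hM : ∀ i j k, regevPoly F word (slice E i k) (slice E j k) ∈ M) :
    ∃ φ ∈ M, IsFoldAlternating N m (fun j => varSet m j) ∅ φ := by
  classical
  have := Fintype.ofFinite T
  have := Fintype.ofFinite K
  let x (i : T × K) : κ → Var G := slice E (e (Sum.inl i.1)) i.2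
  let y (i : T × K) : κ → Var G := slice E (e (Sum.inr i.1)) i.2
  obtain ⟨φ, hφM, hφ, halt⟩ := exists_isMultilinear_biUnion
    (V := fun i => univ.image (Sum.elim (x i) (y i))) (fun i j hij => by
      refine disjoint_left.2 fun v hv hv' => hij ?_
      obtain ⟨z, -, rfl⟩ := mem_image.1 hv
      obtain ⟨z', -, hz⟩ := mem_image.1 hv'
      exact (sumElim_slice_inj e hz).1.symm)
    (f := fun i => regevPoly F word (x i) (y i))
    (fun i => isMultilinear_regevPoly hword fun z z' hz => (sumElim_slice_inj e hz).2)
    (fun i => hM _ _ _) univ_nonempty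
  refine ⟨φ, hφM, isFoldAlternating_varSet (biUnion_varSet_eq_biUnion_slice (E := E) e ▸ hφ)
    fun j g => ?_⟩
  obtain ⟨k, hk⟩ := exists_slice_of_mem_varSet hE g
  have hinj (j : ℕ) : Function.Injective (slice E j k) := fun a b hab => (slice_inj.1 hab).2.2
  have hne (i : T) : (e (Sum.inl i) : ℕ) ≠ e (Sum.inr i) :=
    Fin.val_injective.ne (e.injective.ne Sum.inl_ne_inr)
  obtain ⟨i | i, rfl⟩ := e.surjective j
  · refine halt (i, k) (mem_univ _) _ (fun v hv => ?_) (isAlternating_regevPoly_left (hinj _)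
      (hk _) fun a => slice_notMem_varSet (hne i).symm k a g)
    obtain ⟨a, rfl⟩ := hk _ v hv
    exact mem_image_of_mem _ (mem_univ (Sum.inl a))
  · refine halt (i, k) (mem_univ _) _ (fun v hv => ?_) (isAlternating_regevPoly_right (hinj _)
      (hk _) fun a => slice_notMem_varSet (hne i) k a g)
    obtain ⟨a, rfl⟩ := hk _ v hv
    exact mem_image_of_mem _ (mem_univ (Sum.inr a))

end VariableSets

section HomogeneousBasis

variable {F G A B : Type*} [Field F] [NonUnitalRing A] [Module F A] [Ring B] [Algebra F B]

lemma exists_letters_eq {α : Type*} {l : List α} (hl : l ≠ []) : ∃ w, letters w = l := by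
  obtain ⟨a, l, rfl⟩ := List.exists_cons_of_ne_nil hl
  exact ⟨⟨a, l⟩, rfl⟩

lemma exists_isGradedSubst_map_labelVar {𝒜 : G → Submodule F A} {p : A →ₙₐ[F] B} {m : G → ℕ}
    {y : (Σ g, Fin (m g)) → B} (hy : ∀ s, y s ∈ mapComponent 𝒜 p s.1) :
    ∃ ρ : Var G → A, IsGradedSubst 𝒜 ρ ∧ ∀ j s, p (ρ (labelVar j s)) = y s := by
  have hlift (x : Var G) : ∃ a ∈ 𝒜 x.1, ∀ j s, labelVar j s = x → p a = y s := by
    by_cases hx : ∃ (j : ℕ) (s : Σ g, Fin (m g)), labelVar j s = x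
    · obtain ⟨j, s, rfl⟩ := hx
      obtain ⟨a, ha, hay⟩ := hy s
      exact ⟨a, ha, fun i r hr => hay.trans (congrArg y (labelVar_inj.1 hr).2.symm)⟩
    · exact ⟨0, zero_mem _, fun j s hs => absurd ⟨j, s, hs⟩ hx⟩
  choose ρ hρ hρy using hlift
  exact ⟨ρ, hρ, fun j s => hρy _ j s rfl⟩

variable [CommGroup G]

lemma component_out (ℬ : G → Submodule F B) (g : G) :
    ℬ (g : G ⧸ periodSubgroup ℬ).out = ℬ g := by
  obtain ⟨k, hk⟩ := QuotientGroup.mk_out_eq_mul (periodSubgroup ℬ) g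
  rw [hk, component_mul_period k.2]

lemma IsSimplePregrading.isInternal_out [Finite G] [Nontrivial B]
    [Algebra.IsCentral F B] {ℬ : G → Submodule F B} (h : IsSimplePregrading ℬ)
    [DecidableEq (G ⧸ periodSubgroup ℬ)] :
    DirectSum.IsInternal fun q : G ⧸ periodSubgroup ℬ => ℬ q.out := by
  have := Fintype.ofFinite (G ⧸ periodSubgroup ℬ)
  refine DirectSum.isInternal_submodule_of_iSupIndep_of_iSup_eq_top ?_ ?_
  · have hind := h.supIndep (δ := fun q : G ⧸ periodSubgroup ℬ => q.out) (fun q r hqr => by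
      rwa [← QuotientGroup.eq, QuotientGroup.out_eq', QuotientGroup.out_eq'] at hqr) univ 1
    simp only [one_mul] at hind
    exact hind.iSupIndep_of_univ
  · refine top_le_iff.1 (h.iSup_eq_top.symm.trans_le (iSup_le fun g => ?_))
    rw [← component_out ℬ g]
    exact le_iSup (fun q : G ⧸ periodSubgroup ℬ => ℬ q.out) (g : G ⧸ periodSubgroup ℬ)

theorem IsSimplePregrading.exists_linearIndependent [Finite G]
    [Nontrivial B] [Algebra.IsCentral F B] [Module.Finite F B] {ℬ : G → Submodule F B}
    (h : IsSimplePregrading ℬ) {m : G → ℕ} (hm : ∀ g, Module.finrank F (ℬ g) = m g)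
    {κ : Type*} (β : Module.Basis κ F B) :
    ∃ (b : κ → B) (E : κ × periodSubgroup ℬ ≃ Σ g, Fin (m g)),
      LinearIndependent F b ∧ (∀ i k, b i ∈ ℬ (E (i, k)).1) ∧
      ∀ i j k l, (E (i, k)).1 = (E (j, l)).1 → k = l := by
  classical
  let C := h.isInternal_out.collectedBasis fun q => Module.finBasis F (ℬ q.out)
  let ε := β.indexEquiv C
  let split := Subgroup.groupEquivQuotientProdSubgroup (s := periodSubgroup ℬ)
  have hsplit (q k) : ((split.symm (q, k) : G) : G ⧸ periodSubgroup ℬ) = q :=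
    congrArg Prod.fst (split.apply_symm_apply (q, k))
  have hcomp (q k) : ℬ (split.symm (q, k)) = ℬ q.out := by
    rw [← component_out ℬ (split.symm (q, k)), hsplit]
  let assoc : (Σ q : G ⧸ periodSubgroup ℬ, Fin (Module.finrank F (ℬ q.out))) × periodSubgroup ℬ ≃
      Σ z : (G ⧸ periodSubgroup ℬ) × periodSubgroup ℬ, Fin (Module.finrank F (ℬ z.1.out)) :=
    ⟨fun z => ⟨(z.1.1, z.2), z.1.2⟩, fun z => (⟨z.1.1, z.2⟩, z.1.2), fun _ => rfl, fun _ => rfl⟩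
  refine ⟨C ∘ ε, ((ε.prodCongr (Equiv.refl _)).trans assoc).trans
    (Equiv.sigmaCongr split.symm fun z => finCongr (by rw [← hm, hcomp])),
    C.linearIndependent.comp _ ε.injective, fun i k => ?_, fun i j k l hkl => ?_⟩
  · change C (ε i) ∈ ℬ (split.symm ((ε i).1, k))
    rw [hcomp, DirectSum.IsInternal.collectedBasis_coe]
    exact Subtype.mem _
  · exact (Prod.mk.inj (split.symm.injective hkl)).2

variable [CharZero F] [Fintype G] [DecidableEq G] [IsScalarTower F A A] [SMulCommClass F A A]

theorem exists_eval_mem_centralUnitPreimage {n : ℕ} [NeZero n] {𝒜 : G → Submodule F A}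
    (h : IsGrading 𝒜) (hs : IsGradedSimple 𝒜) {p : A →ₙₐ[F] Matrix (Fin n) (Fin n) F}
    (hp : Function.Surjective p) {t : ℕ} (ht : 1 ≤ t) :
    ∃ φ : GradedPoly F G, IsFoldAlternating (2 * t) (gDim 𝒜) (fun j => varSet (gDim 𝒜) j) ∅ φ ∧
      ∃ ρ : Var G → A, IsGradedSubst 𝒜 ρ ∧ eval ρ φ ∈ centralUnitPreimage p := by
  classical
  have : NeZero t := ⟨by lia⟩
  obtain ⟨b, E, hb, hbE, hE⟩ := (isSimplePregrading_mapComponent h hs hp).exists_linearIndependent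
    (finrank_mapComponent h hs hp) (Matrix.stdBasis F (Fin n) (Fin n))
  obtain ⟨ρ, hρ, hpρ⟩ := exists_isGradedSubst_map_labelVar (y := fun s => b (E.symm s).1)
    fun s => by simpa only [Prod.mk.eta, E.apply_symm_apply] using hbE (E.symm s).1 (E.symm s).2
  obtain ⟨l, hl, hregev⟩ := exists_word_regevSum_eq_scalar F (Fin n)
  obtain ⟨word, rfl⟩ := exists_letters_eq (l := l) fun hnil =>
    univ_nonempty.ne_empty (Finset.val_inj.1 (by rw [← hl, hnil]; rfl))
  obtain ⟨c, hc, hcb⟩ := hregev b hb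
  have hslice (j : ℕ) (k) : p ∘ ρ ∘ slice E j k = b := funext fun a => by
    simp only [Function.comp_apply, slice, hpρ, E.symm_apply_apply]
  have hunit (i j : ℕ) (k) :
      eval ρ (regevPoly F word (slice E i k) (slice E j k)) ∈ centralUnitPreimage p := by
    rw [mem_centralUnitPreimage, map_eval_regevPoly, hslice, hslice, hcb]
    exact ⟨Semigroup.mem_center_iff.2 fun X => (Matrix.scalar_commute c (Commute.all c) X).symm,
      (IsUnit.mk0 c hc).map (Matrix.scalar (Fin n))⟩
  obtain ⟨φ, hφM, hφ⟩ := exists_isFoldAlternating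
    (finSumFinEquiv.trans (finCongr (two_mul t).symm)) hE hl hunit
      (M := (centralUnitPreimage p).comap
        ((eval ρ : GradedPoly F G →ₙₐ[F] A) : GradedPoly F G →ₙ* A))
  exact ⟨φ, hφ, ρ, hρ, hφM⟩

end HomogeneousBasis

end GradedPI

theorem lemma4p9 {F G A : Type*} [Field F] [IsAlgClosed F] [CharZero F]
    [CommGroup G] [Fintype G] [DecidableEq G]
    [NonUnitalRing A] [Module F A] [IsScalarTower F A A] [SMulCommClass F A A]
    [FiniteDimensional F A]
    (𝒜 : G → Submodule F A) (h_grading : GradedPI.IsGrading 𝒜)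
    (h_simple : GradedPI.IsGradedSimple 𝒜) (t : ℕ) (ht : 1 ≤ t) :
    ∃ (X : Fin (2 * t) → G → Finset (GradedPI.Var G)) (φ : GradedPI.GradedPoly F G),
      GradedPI.IsFoldAlternating (2 * t) (GradedPI.gDim 𝒜) X ∅ φ ∧
      ¬ GradedPI.IsGradedIdentity 𝒜 φ ∧
      ∃ ρ : GradedPI.Var G → A, GradedPI.IsGradedSubst 𝒜 ρ ∧
        GradedPI.eval ρ φ ∈ Set.center A ∧ GradedPI.IsInvertible (GradedPI.eval ρ φ) := by
  obtain ⟨a, b, hab⟩ := h_simple.exists_mul_ne_zero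
  have : Nontrivial A := ⟨a * b, 0, hab⟩
  obtain ⟨n, _, p, hp⟩ :=
    GradedPI.exists_surjective_matrix (h_simple.map₂_mul_eq_top h_grading)
  obtain ⟨φ, hφ, ρ, hρ, hunit⟩ :=
    GradedPI.exists_eval_mem_centralUnitPreimage h_grading h_simple hp ht
  have hne : GradedPI.eval ρ φ ≠ 0 := fun hzero =>
    (GradedPI.mem_centralUnitPreimage.1 hunit).2.ne_zero (by rw [hzero, map_zero])
  exact ⟨_, φ, hφ, fun hid => hne (hid ρ hρ), ρ, hρ,
    GradedPI.mem_center_and_isInvertible h_grading h_simple hp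
      (GradedPI.eval_mem_of_isMultilinear h_grading hρ hφ.multilinear) hunit⟩
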